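/- **Thermodynamics.** Each phase $k\in\{1,2\}$ has a complete equation of state on an open set $D_k$ of admissible pairs $(\rho_k,e_k)$ of positive numbers ($D_k=(0,\infty)^2$ for a general law, $D_k=\{\rho_k e_k>p_{\infty,k}\}$ for a stiffened gas): continuously differentiable functions $p_k$ (pressure) and $T_k>0$ (temperature) and an entropy $s_k$ with $ds_k=\frac1{T_k}\big(\frac{p_k}{\rho_k^2}\,d\rho_k-de_k\big)$, strictly convex as a function of $(\tau_k,e_k)$, $\tau_k=1/\rho_k$. The set of values of $e\mapsto s_k(\rho,e)$ is the same for all $\rho>0$. The inverse of the decreasing map $e\mapsto s_k(1/\tau,e)$ is written $e_k(\tau,s)$, and $\mathcal P_k(\tau,s)=p_k(1/\tau,e_k(\tau,s))$, $E_k=u_k^2/2+e_k(\tau_k,s_k)$. **States.** With $\alpha_2=1-\alpha_1$ let $U=(\alpha_1,\alpha_1\rho_1,\alpha_2\rho_2,\alpha_1\rho_1u_1,\alpha_2\rho_2u_2,\alpha_1\rho_1s_1,\alpha_2\rho_2s_2)\in\mathbb R^7$ and $\Omega_U=\{0<\alpha_1<1,\ \alpha_k\rho_k>0,\ \alpha_k\rho_ke_k(\tau_k,s_k)>0,\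 k=1,2\}$ (the last condition includes that $e_k(\tau_k,s_k)$ is defined). Relaxation states $W\in\mathbb R^9$ have the additional components $\alpha_k\rho_k\mathcal T_k$, $k=1,2$; $\Omega_W=\{0<\alpha_1<1,\ \alpha_k\rho_k>0,\ \alpha_k\rho_k\mathcal T_k>0\}$; $\mathscr P$ drops these two components and $\mathscr M(U)$ is the relaxation state over $U$ with $\mathcal T_k=\tau_k$. For $a=(a_1,a_2)$, $a_k>0$, put $\pi_k=\mathcal P_k(\mathcal T_k,s_k)+a_k^2(\mathcal T_k-\tau_k)$ and $\mathcal E_k=\frac{u_k^2}2+e_k(\mathcal T_k,s_k)+\frac{\pi_k^2-\mathcal P_k(\mathcal T_k,s_k)^2}{2a_k^2}$, and let $\mathbf g(W)$ have the components $0$; $\alpha_k\rho_ku_k$; $\alpha_k\rho_ku_k^2+\alpha_k\pi_k$; $\alpha_k\rho_ks_ku_k$; $\alpha_k\rho_k\mathcal T_ku_k$ (in the order of $W$). **Riemann solutions.** A solution with subsonic wave ordering of the relaxation Riemann problem with data $W_L,W_R\in\Omega_W$ is a profile $\xi=x/t\mapsto W_r(\xi;W_L,W_R)$ together with numbers $u_2^*,\pi_1^*$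 such that: (i) $W_r$ is piecewise constant with values in $\Omega_W$ and at most six discontinuities, each a contact discontinuity associated with one of the eigenvalues $u_k,\ u_k\pm a_k\tau_k$; it equals $W_L$ for $\xi<\min_k(u_{k,L}-a_k\tau_{k,L})$ and $W_R$ for $\xi>\max_k(u_{k,R}+a_k\tau_{k,R})$; (ii) in the sense of distributions on $t>0$, with $\partial_x\alpha_k:=(\alpha_{k,R}-\alpha_{k,L})\delta_{x-u_2^*t}$ in the nonconservative products, $\partial_t\alpha_k+u_2^*\partial_x\alpha_k=0$, $\partial_t(\alpha_k\rho_k)+\partial_x(\alpha_k\rho_ku_k)=0$, $\partial_t(\alpha_k\rho_ku_k)+\partial_x(\alpha_k\rho_ku_k^2+\alpha_k\pi_k)-\pi_1^*\partial_x\alpha_k=0$, $\partial_t(\alpha_k\rho_ks_k)+\partial_x(\alpha_k\rho_ks_ku_k)=0$, $\partial_t(\alpha_k\rho_k\mathcal T_k)+\partial_x(\alpha_k\rho_k\mathcal T_ku_k)=0$; (iii) $\partial_t(\alpha_k\rho_k\mathcal E_k)+\partial_x(\alpha_k\rho_k\mathcal E_ku_k+\alpha_k\pi_ku_k)-u_2^*\pi_1^*\partial_x\alpha_k=-Q_k\delta_{x-u_2^*t}$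 with $Q_2=0$ and some $Q_1\ge0$; (iv) $u_{1,L}-a_1\tau_{1,L}<u_2^*<u_{1,R}+a_1\tau_{1,R}$. **Scheme.** Let $\Delta t,\Delta x>0$, let $(a_k)^n_{j+1/2}>0$ be relaxation parameters at the interfaces, and let $W_r$ be a Riemann solver. With $\mathbf D^*=(\alpha_{1,R}-\alpha_{1,L})(u_2^*,0,0,-\pi_1^*,\pi_1^*,0,0,0,0)^T$ put $$\mathbf F^-(U_L,U_R)=\mathscr P\mathbf g(W_r(0^-))+\mathscr P\mathbf D^*\mathbf 1_{\{u_2^*<0\}},\qquad \mathbf F^+(U_L,U_R)=\mathscr P\mathbf g(W_r(0^+))-\mathscr P\mathbf D^*\mathbf 1_{\{u_2^*>0\}},$$ where $W_r(\cdot)=W_r(\cdot;\mathscr M(U_L),\mathscr M(U_R))$ and each interface uses its own parameters, and $$U_j^{n+1}=U_j^n-\tfrac{\Delta t}{\Delta x}\big(\mathbf F^-(U_j^n,U_{j+1}^n)-\mathbf F^+(U_{j-1}^n,U_j^n)\big),\qquad n\in\mathbb N,\ j\in\mathbb Z.$$ The CFL condition at time $n$ is: $\frac{\Delta t}{\Delta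 x}|(u_k)_j^n-(a_k)^n_{j+1/2}(\tau_k)_j^n|<\frac12$ and $\frac{\Delta t}{\Delta x}|(u_k)_{j+1}^n+(a_k)^n_{j+1/2}(\tau_k)_{j+1}^n|<\frac12$ for all $k,j$. **Proposition.** The scheme has the following properties, at every $n$ at which $W_r$ provides, for all $j$, a solution with subsonic wave ordering at the interface between $U_j^n$ and $U_{j+1}^n$. 1. *Positivity.* If $U_j^n\in\Omega_U$ for all $j$ and the CFL condition holds at time $n$, then $0<(\alpha_k)_j^{n+1}<1$, $(\alpha_k\rho_k)_j^{n+1}>0$ and $(\alpha_k\rho_ke_k(\tau_k,s_k))_j^{n+1}>0$ for $k=1,2$ and all $j$, i.e. $U_j^{n+1}\in\Omega_U$. If moreover phase $k$ is an ideal or stiffened gas, $p_k=(\gamma_k-1)\rho_ke_k-\gamma_kp_{\infty,k}$ on $D_k$ with $\gamma_k>1$, $p_{\infty,k}\ge0$, then $$(\rho_ke_k(\tau_k,s_k))_j^n-p_{\infty,k}>0\ \ \forall j\quad\Longrightarrow\quad(\rho_ke_k(\tau_k,s_k))_j^{n+1}-p_{\infty,k}>0\ \ \forall j.$$ 2. *Phasic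 mass, phasic entropy and total momentum conservation.* Whenever $W_r$ provides a solution at an interface $(U_L,U_R)$, $\mathbf F^-_i(U_L,U_R)=\mathbf F^+_i(U_L,U_R)$ for $i\in\{2,3,6,7\}$ and $\mathbf F^-_4+\mathbf F^-_5=\mathbf F^+_4+\mathbf F^+_5$. Hence $(\alpha_k\rho_k)_j$, $(\alpha_k\rho_ks_k)_j$ $(k=1,2)$ and $\sum_k(\alpha_k\rho_ku_k)_j$ are updated by the conservative formula $X_j^{n+1}=X_j^n-\frac{\Delta t}{\Delta x}(\Phi_{j+1/2}^n-\Phi_{j-1/2}^n)$, where $\Phi_{j+1/2}^n$ is the common value at $(U_j^n,U_{j+1}^n)$ of $\mathbf F^\pm_{1+k}$, $\mathbf F^\pm_{5+k}$ and $\mathbf F^\pm_4+\mathbf F^\pm_5$ respectively. 3. *Discrete energy inequalities.* Suppose $U_j^n\in\Omega_U$ for all $j$, the CFL condition holds at time $n$, and Whitham's condition holds at each interface: for $k=1,2$, all $j$, and each value of the fan $\xi\mapsto W_r(\xi;\mathscr M(U_j^n),\mathscr M(U_{j+1}^n))$ (off its discontinuities), $$\big((a_k)^n_{j+1/2}\big)^2>-\partial_{\tau_k}\mathcal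 P_k(\theta,s_k)$$ with $s_k=s_k(\xi)$ and for every specific volume $\theta$ between $\mathcal T_k(\xi)$ and $\tau_k(\xi)$ (both included). Then for all $j$ and $k=1,2$ $$\begin{aligned}(\alpha_k\rho_kE_k)(U_j^{n+1})\le{}&(\alpha_k\rho_kE_k)(U_j^n)-\tfrac{\Delta t}{\Delta x}\big(G_{k,j+1/2}^n-G_{k,j-1/2}^n\big)\\&+\tfrac{\Delta t}{\Delta x}\mathbf 1_{\{(u_2^*)^n_{j-1/2}\ge0\}}(u_2^*\pi_1^*)^n_{j-1/2}\big((\alpha_k)_j^n-(\alpha_k)_{j-1}^n\big)\\&+\tfrac{\Delta t}{\Delta x}\mathbf 1_{\{(u_2^*)^n_{j+1/2}\le0\}}(u_2^*\pi_1^*)^n_{j+1/2}\big((\alpha_k)_{j+1}^n-(\alpha_k)_j^n\big),\end{aligned}$$ where $G_{k,j+1/2}^n=(\alpha_k\rho_k\mathcal E_ku_k+\alpha_k\pi_ku_k)\big(W_r(0^+;\mathscr M(U_j^n),\mathscr M(U_{j+1}^n))\big)$. -/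

import Mathlib

open Set Filter Topology MeasureTheory
open scoped ContDiff

noncomputable section

namespace BaerNunziato

/-! ### Thermodynamics of one phase -/

/-- Complete equation of state of one phase in the variables density `ρ` and specific internal
energy `e`: pressure `p`, temperature `T` (the positive integrating factor) and mathematical
entropy `s`, with `ds = (1/T) (p / ρ² dρ - de)` and `s` strictly convex as a function of the
specific volume `τ = 1/ρ` and of `e`.

`dom` is the set of admissible pairs `(ρ, e)`: all pairs of positive numbers for a general law
(for instance an ideal gas), and the pairs with `ρ e > p_∞` for a stiffened gas, whose temperature
and entropy make sense only there. -/
structure PhaseEOS where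
  dom : Set (ℝ × ℝ)
  p : ℝ → ℝ → ℝ
  T : ℝ → ℝ → ℝ
  s : ℝ → ℝ → ℝ
  dom_pos : ∀ ρ e, (ρ, e) ∈ dom → 0 < ρ ∧ 0 < e
  dom_open : IsOpen dom
  T_pos : ∀ ρ e, (ρ, e) ∈ dom → 0 < T ρ e
  p_contDiff : ContDiffOn ℝ 1 (fun x : ℝ × ℝ => p x.1 x.2) dom
  T_contDiff : ContDiffOn ℝ 1 (fun x : ℝ × ℝ => T x.1 x.2) dom
  second_law : ∀ ρ e, (ρ, e) ∈ dom →
    HasFDerivAt (fun x : ℝ × ℝ => s x.1 x.2)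
      ((1 / T ρ e) •
        ((p ρ e / ρ ^ 2) • ContinuousLinearMap.fst ℝ ℝ ℝ - ContinuousLinearMap.snd ℝ ℝ ℝ)) (ρ, e)
  s_convex : StrictConvexOn ℝ {x : ℝ × ℝ | (1 / x.1, x.2) ∈ dom} (fun x => s (1 / x.1) x.2)
  /-- The values of `e ↦ s(ρ, e)` are the same for all densities: the inverse function
  `s ↦ e(τ, s)` is defined on a set of entropies that does not depend on `τ > 0`. -/
  s_range : ∀ ρ ρ', 0 < ρ → 0 < ρ' → ∀ e, (ρ, e) ∈ dom → ∃ e', (ρ', e') ∈ dom ∧ s ρ' e' = s ρ e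

namespace PhaseEOS

variable (E : PhaseEOS)

open Classical in
/-- The internal energy `e(τ, s)`: the inverse of `e ↦ s(1/τ, e)` (which is strictly decreasing,
so that there is at most one such `e`). The value is `0` where the inverse is not defined, so
`0 < e(τ, s)` says that it is defined. -/
def energy (τ s : ℝ) : ℝ :=
  if h : ∃ e, (1 / τ, e) ∈ E.dom ∧ E.s (1 / τ) e = s then h.choose else 0

/-- The pressure `𝒫(τ, s) = p(1/τ, e(τ, s))`. -/
def pressure (τ s : ℝ) : ℝ := E.p (1 / τ) (E.energy τ s)

/-- Stiffened gas law `p = (γ - 1) ρ e - γ p_∞`; an ideal gas is the case `p_∞ = 0`. -/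
def IsStiffenedGas (γ pinf : ℝ) : Prop :=
  1 < γ ∧ 0 ≤ pinf ∧ ∀ ρ e, (ρ, e) ∈ E.dom → E.p ρ e = (γ - 1) * ρ * e - γ * pinf

end PhaseEOS

/-! ### State vectors

Phases 1 and 2 are the indices `0` and `1` of `Fin 2`; vector components are numbered from `0`. -/

/-- `U = (α₁, α₁ρ₁, α₂ρ₂, α₁ρ₁u₁, α₂ρ₂u₂, α₁ρ₁s₁, α₂ρ₂s₂)`. -/
abbrev AuxState := Fin 7 → ℝ

/-- `W = (α₁, α₁ρ₁, α₂ρ₂, α₁ρ₁u₁, α₂ρ₂u₂, α₁ρ₁s₁, α₂ρ₂s₂, α₁ρ₁𝒯₁, α₂ρ₂𝒯₂)`. -/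
abbrev RelaxState := Fin 9 → ℝ

def massIdx (k : Fin 2) : Fin 7 := ![1, 2] k
def momIdx (k : Fin 2) : Fin 7 := ![3, 4] k
def entIdx (k : Fin 2) : Fin 7 := ![5, 6] k

/-- Phase fraction `α_k`, with `α₂ = 1 - α₁`. -/
def alpha (U : AuxState) (k : Fin 2) : ℝ := ![U 0, 1 - U 0] k
/-- Partial mass `α_k ρ_k`. -/
def mass (U : AuxState) (k : Fin 2) : ℝ := U (massIdx k)
/-- Partial momentum `α_k ρ_k u_k`. -/
def mom (U : AuxState) (k : Fin 2) : ℝ := U (momIdx k)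
/-- Partial entropy `α_k ρ_k s_k`. -/
def ent (U : AuxState) (k : Fin 2) : ℝ := U (entIdx k)
/-- Specific volume `τ_k = 1 / ρ_k`. -/
def vol (U : AuxState) (k : Fin 2) : ℝ := alpha U k / mass U k
/-- Velocity `u_k`. -/
def vel (U : AuxState) (k : Fin 2) : ℝ := mom U k / mass U k
/-- Specific entropy `s_k`. -/
def spEnt (U : AuxState) (k : Fin 2) : ℝ := ent U k / mass U k

/-- `𝒫`: drop the relaxation unknowns. -/
def proj (W : RelaxState) : AuxState := ![W 0, W 1, W 2, W 3, W 4, W 5, W 6]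
/-- `ℳ`: the equilibrium relaxation state, `𝒯_k = τ_k`. -/
def lift (U : AuxState) : RelaxState :=
  ![U 0, U 1, U 2, U 3, U 4, U 5, U 6, U 0, 1 - U 0]
/-- Relaxation specific volume `𝒯_k`. -/
def relVol (W : RelaxState) (k : Fin 2) : ℝ := ![W 7, W 8] k / mass (proj W) k

variable (eos : Fin 2 → PhaseEOS)

/-- `e_k(τ_k, s_k)` in the state `U`. -/
def intEnergy (U : AuxState) (k : Fin 2) : ℝ := (eos k).energy (vol U k) (spEnt U k)

/-- `α_k ρ_k E_k`, with `E_k = u_k² / 2 + e_k(τ_k, s_k)`. -/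
def totEnergy (U : AuxState) (k : Fin 2) : ℝ :=
  mass U k * (vel U k ^ 2 / 2 + intEnergy eos U k)

/-- The physical space `Ω_U` of the auxiliary model. -/
def OmegaU : Set AuxState :=
  {U | 0 < U 0 ∧ U 0 < 1 ∧ ∀ k, 0 < mass U k ∧ 0 < mass U k * intEnergy eos U k}

/-- The space `Ω_W` of admissible relaxation states. -/
def OmegaW : Set RelaxState :=
  {W | 0 < W 0 ∧ W 0 < 1 ∧ (∀ k, 0 < mass (proj W) k) ∧ 0 < W 7 ∧ 0 < W 8}

/-! ### The relaxation system, with relaxation parameters `a = (a₁, a₂)` -/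

/-- Linearized pressure `π_k = 𝒫_k(𝒯_k, s_k) + a_k² (𝒯_k - τ_k)`. -/
def relPressure (a : Fin 2 → ℝ) (W : RelaxState) (k : Fin 2) : ℝ :=
  (eos k).pressure (relVol W k) (spEnt (proj W) k) + a k ^ 2 * (relVol W k - vol (proj W) k)

/-- Relaxation energy
`ℰ_k = u_k² / 2 + e_k(𝒯_k, s_k) + (π_k² - 𝒫_k(𝒯_k, s_k)²) / (2 a_k²)`. -/
def relEnergy (a : Fin 2 → ℝ) (W : RelaxState) (k : Fin 2) : ℝ :=
  vel (proj W) k ^ 2 / 2 + (eos k).energy (relVol W k) (spEnt (proj W) k)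
    + (relPressure eos a W k ^ 2 - (eos k).pressure (relVol W k) (spEnt (proj W) k) ^ 2)
      / (2 * a k ^ 2)

/-- Momentum flux `α_k ρ_k u_k² + α_k π_k`. -/
def momFlux (a : Fin 2 → ℝ) (W : RelaxState) (k : Fin 2) : ℝ :=
  mass (proj W) k * vel (proj W) k ^ 2 + alpha (proj W) k * relPressure eos a W k

/-- Energy flux `α_k ρ_k ℰ_k u_k + α_k π_k u_k`. -/
def energyFlux (a : Fin 2 → ℝ) (W : RelaxState) (k : Fin 2) : ℝ :=
  mass (proj W) k * relEnergy eos a W k * vel (proj W) k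
    + alpha (proj W) k * relPressure eos a W k * vel (proj W) k

/-- The flux `g(W)` of the relaxation system. -/
def relFlux (a : Fin 2 → ℝ) (W : RelaxState) : RelaxState :=
  ![0,
    mass (proj W) 0 * vel (proj W) 0, mass (proj W) 1 * vel (proj W) 1,
    momFlux eos a W 0, momFlux eos a W 1,
    ent (proj W) 0 * vel (proj W) 0, ent (proj W) 1 * vel (proj W) 1,
    W 7 * vel (proj W) 0, W 8 * vel (proj W) 1]

/-! ### The Riemann problem for the relaxation system -/

/-- `∂ₜ A(x/t) + ∂ₓ B(x/t) = c δ_{x - σ t}` in the sense of distributions on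
`{(x, t) : t > 0}`, where `δ_{x - σ t}` is the distribution `φ ↦ ∫ φ(σ t, t) dt`. -/
def SelfSimilarBalance (A B : ℝ → ℝ) (c σ : ℝ) : Prop :=
  ∀ φ : ℝ × ℝ → ℝ, ContDiff ℝ ∞ φ → HasCompactSupport φ → tsupport φ ⊆ {q | 0 < q.2} →
    ∫ q : ℝ × ℝ, (A (q.1 / q.2) * fderiv ℝ φ q (0, 1) + B (q.1 / q.2) * fderiv ℝ φ q (1, 0))
      = -(c * ∫ t in Ioi (0 : ℝ), φ (σ * t, t))

/-- A self-similar profile `ξ ↦ W(ξ)` together with the numbers `u₂*` and `π₁*`. -/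
structure Fan where
  W : ℝ → RelaxState
  u2 : ℝ
  pi1 : ℝ

/-- `f` is a solution with subsonic wave ordering of the Riemann problem with initial states
`WL`, `WR` for the relaxation system with parameters `a`. In the balance laws the measure
`∂ₓ α_k` is `(α_{k,R} - α_{k,L}) δ_{x - u₂* t}`. The values of `f.W` at the (at most six) speeds
of discontinuity are irrelevant. -/
structure IsRiemannSolution (a : Fin 2 → ℝ) (WL WR : RelaxState) (f : Fan) : Prop where
  /-- Piecewise constant in `Ω_W`, with at most six discontinuities, each of which is a contact
  discontinuity for one of the eigenvalues `u_k`, `u_k ± a_k τ_k`. -/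
  piecewise_const : ∃ S : Finset ℝ, S.card ≤ 6 ∧
    (∀ ξ η, ξ ≤ η → (∀ σ ∈ S, σ ∉ Icc ξ η) → f.W ξ = f.W η) ∧
    (∀ ξ, ξ ∉ S → f.W ξ ∈ OmegaW) ∧
    (∀ σ ∈ S, ∃ k : Fin 2, ∃ ε ∈ ({-1, 0, 1} : Set ℝ),
      (∀ᶠ ξ in 𝓝[<] σ, vel (proj (f.W ξ)) k + ε * (a k * vol (proj (f.W ξ)) k) = σ) ∧
      (∀ᶠ ξ in 𝓝[>] σ, vel (proj (f.W ξ)) k + ε * (a k * vol (proj (f.W ξ)) k) = σ))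
  left_state : ∀ ξ, (∀ k, ξ < vel (proj WL) k - a k * vol (proj WL) k) → f.W ξ = WL
  right_state : ∀ ξ, (∀ k, vel (proj WR) k + a k * vol (proj WR) k < ξ) → f.W ξ = WR
  fraction_eq : ∀ k, SelfSimilarBalance
    (fun ξ => alpha (proj (f.W ξ)) k) (fun ξ => f.u2 * alpha (proj (f.W ξ)) k) 0 f.u2
  mass_eq : ∀ k, SelfSimilarBalance
    (fun ξ => mass (proj (f.W ξ)) k)
    (fun ξ => mass (proj (f.W ξ)) k * vel (proj (f.W ξ)) k) 0 f.u2
  momentum_eq : ∀ k, SelfSimilarBalance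
    (fun ξ => mass (proj (f.W ξ)) k * vel (proj (f.W ξ)) k)
    (fun ξ => momFlux eos a (f.W ξ) k)
    (f.pi1 * (alpha (proj WR) k - alpha (proj WL) k)) f.u2
  entropy_eq : ∀ k, SelfSimilarBalance
    (fun ξ => mass (proj (f.W ξ)) k * spEnt (proj (f.W ξ)) k)
    (fun ξ => mass (proj (f.W ξ)) k * spEnt (proj (f.W ξ)) k * vel (proj (f.W ξ)) k) 0 f.u2
  relVol_eq : ∀ k, SelfSimilarBalance
    (fun ξ => mass (proj (f.W ξ)) k * relVol (f.W ξ) k)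
    (fun ξ => mass (proj (f.W ξ)) k * relVol (f.W ξ) k * vel (proj (f.W ξ)) k) 0 f.u2
  /-- Energy equation of phase 2. -/
  energy_eq_two : SelfSimilarBalance
    (fun ξ => mass (proj (f.W ξ)) 1 * relEnergy eos a (f.W ξ) 1)
    (fun ξ => energyFlux eos a (f.W ξ) 1)
    (f.u2 * f.pi1 * (alpha (proj WR) 1 - alpha (proj WL) 1)) f.u2
  /-- Energy equation of phase 1, with a nonnegative dissipation on the `u₂`-wave. -/
  energy_eq_one : ∃ Q : ℝ, 0 ≤ Q ∧ SelfSimilarBalance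
    (fun ξ => mass (proj (f.W ξ)) 0 * relEnergy eos a (f.W ξ) 0)
    (fun ξ => energyFlux eos a (f.W ξ) 0)
    (f.u2 * f.pi1 * (alpha (proj WR) 0 - alpha (proj WL) 0) - Q) f.u2
  subsonic_left : vel (proj WL) 0 - a 0 * vol (proj WL) 0 < f.u2
  subsonic_right : f.u2 < vel (proj WR) 0 + a 0 * vol (proj WR) 0

/-! ### The relaxation finite volume scheme -/

/-- A Riemann solver: a choice of a fan for relaxation parameters `a` and states `WL`, `WR`. -/
abbrev RiemannSolver := (Fin 2 → ℝ) → RelaxState → RelaxState → Fan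

/-- The fan `W_r(·; ℳ(UL), ℳ(UR))` computed with the relaxation parameters `a`. -/
def interfaceFan (Wr : RiemannSolver) (a : Fin 2 → ℝ) (UL UR : AuxState) : Fan :=
  Wr a (lift UL) (lift UR)

/-- The solver returns a solution of the relaxation Riemann problem at an interface between
`UL` and `UR`. -/
def SolvesInterface (Wr : RiemannSolver) (a : Fin 2 → ℝ) (UL UR : AuxState) : Prop :=
  IsRiemannSolution eos a (lift UL) (lift UR) (interfaceFan Wr a UL UR)

/-- `D*(WL, WR) = (α_{1,R} - α_{1,L}) (u₂*, 0, 0, -π₁*, π₁*, 0, 0, 0, 0)`. -/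
def Dstar (WL WR : RelaxState) (f : Fan) : RelaxState :=
  (WR 0 - WL 0) • ![f.u2, 0, 0, -f.pi1, f.pi1, 0, 0, 0, 0]

/-- The numerical flux `F⁻(UL, UR)`. -/
def fluxMinus (Wr : RiemannSolver) (a : Fin 2 → ℝ) (UL UR : AuxState) : AuxState :=
  proj (relFlux eos a (Function.leftLim (interfaceFan Wr a UL UR).W 0))
    + if (interfaceFan Wr a UL UR).u2 < 0 then
        proj (Dstar (lift UL) (lift UR) (interfaceFan Wr a UL UR)) else 0

/-- The numerical flux `F⁺(UL, UR)`. -/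
def fluxPlus (Wr : RiemannSolver) (a : Fin 2 → ℝ) (UL UR : AuxState) : AuxState :=
  proj (relFlux eos a (Function.rightLim (interfaceFan Wr a UL UR).W 0))
    - if 0 < (interfaceFan Wr a UL UR).u2 then
        proj (Dstar (lift UL) (lift UR) (interfaceFan Wr a UL UR)) else 0

/-- The scheme `U_j^{n+1} = U_j^n - Δt/Δx (F⁻(U_j^n, U_{j+1}^n) - F⁺(U_{j-1}^n, U_j^n))`;
`a n j` are the relaxation parameters at the interface `x_{j+1/2}` at time `tⁿ`. -/
def IsScheme (Wr : RiemannSolver) (Δt Δx : ℝ) (a : ℕ → ℤ → Fin 2 → ℝ)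
    (U : ℕ → ℤ → AuxState) : Prop :=
  ∀ n j, U (n + 1) j = U n j - (Δt / Δx) •
    (fluxMinus eos Wr (a n j) (U n j) (U n (j + 1))
      - fluxPlus eos Wr (a n (j - 1)) (U n (j - 1)) (U n j))

/-- CFL condition for the data `U` and the interface parameters `a` (at a given time). -/
def CFL (Δt Δx : ℝ) (a : ℤ → Fin 2 → ℝ) (U : ℤ → AuxState) : Prop :=
  ∀ (j : ℤ) (k : Fin 2),
    Δt / Δx * |vel (U j) k - a j k * vol (U j) k| < 1 / 2 ∧
    Δt / Δx * |vel (U (j + 1)) k + a j k * vol (U (j + 1)) k| < 1 / 2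

/-- Whitham's condition `a_k² > -∂_τ 𝒫_k(θ, s_k)` in the fan `f`: for (almost) all `ξ`, with
`s_k` the entropy at `ξ`, and for all specific volumes `θ` from the value of the relaxation
unknown `𝒯_k` at `ξ` to its equilibrium value `τ_k` at `ξ`. -/
def Whitham (a : Fin 2 → ℝ) (f : Fan) : Prop :=
  ∀ k, ∀ᵐ ξ : ℝ, ∀ θ ∈ uIcc (relVol (f.W ξ) k) (vol (proj (f.W ξ)) k),
    -deriv (fun τ => (eos k).pressure τ (spEnt (proj (f.W ξ)) k)) θ < a k ^ 2

/-- The energy flux at an interface: right trace of `α_k ρ_k ℰ_k u_k + α_k π_k u_k`. -/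
def interfaceEnergyFlux (Wr : RiemannSolver) (a : Fin 2 → ℝ) (UL UR : AuxState) (k : Fin 2) : ℝ :=
  energyFlux eos a (Function.rightLim (interfaceFan Wr a UL UR).W 0) k

end BaerNunziato

end

/-! The scheme is of Godunov type. Under the half-cell CFL condition the fan issued from each
interface has already reached the state of the cell when it arrives at the cell centre, and the
subsonic ordering keeps the `u₂*`-wave inside the fan. Integrating the balance laws over half a fan
therefore expresses the numerical fluxes, nonconservative part included, through integrals of the
fan. The updated state is exactly the average over the cell of the right half of one fan and the
left half of the next (`isCellAverage_step`). The physical fluxes of the cell state cancel, because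
at equilibrium they do not depend on the relaxation parameters.

Positivity: fractions and masses of an average of states in `OmegaW` are positive. The specific
entropy is transported by the phase velocity, so in a fan it takes only the two initial values
(`spEnt_eq_or`). After averaging it is a mass-weighted mean of such values, and the set of
admissible entropies is an interval, so `e(τ, s)` is defined and positive. For a stiffened gas `(ρe
- p_∞) τ^γ` depends on `s` alone; since `e` decreases in `s`, a bound at one of the neighbouring
states passes to the average.

Conservation is the Rankine–Hugoniot relation at `ξ = 0`: mass and entropy have no source, and the
two momentum sources are opposite.

Energy: `α_k ρ_k E_k` has a supporting affine function at every admissible state, which gives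
Jensen's inequality for the cell average (`tangent_le_totEnergy`). Whitham's condition makes the
relaxation energy dominate the total energy inside the fan (`totEnergy_le_relEnergy`). The integral
of the relaxation energy is given by its balance law, where the dissipation `Q ≥ 0` only helps.

The link with the distributional formulation is `SelfSimilarBalance.rankine_hugoniot`, obtained with
test functions concentrated along a ray. -/

namespace BaerNunziato

/-! ### Rankine–Hugoniot relations from the weak formulation. -/

/-- The shear `(y, t) ↦ (y + ξ t, t)`. -/
def shear (ξ : ℝ) : ℝ × ℝ ≃ᵐ ℝ × ℝ where
  toFun q := (q.1 + ξ * q.2, q.2)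
  invFun q := (q.1 - ξ * q.2, q.2)
  left_inv q := by ext <;> simp
  right_inv q := by ext <;> simp
  measurable_toFun := by
    change Measurable fun q : ℝ × ℝ => (q.1 + ξ * q.2, q.2)
    fun_prop
  measurable_invFun := by
    change Measurable fun q : ℝ × ℝ => (q.1 - ξ * q.2, q.2)
    fun_prop

lemma shear_apply (ξ : ℝ) (q : ℝ × ℝ) : shear ξ q = (q.1 + ξ * q.2, q.2) := rfl

/-- On each line of constant time the shear is a translation. The swaps put time first, as the skew
product requires. -/
lemma measurePreserving_shear (ξ : ℝ) :
    MeasurePreserving (shear ξ) (volume : Measure (ℝ × ℝ)) volume := by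
  have h1 : MeasurePreserving (fun p : ℝ × ℝ => (p.1, p.2 + ξ * p.1))
      ((volume : Measure ℝ).prod volume) ((volume : Measure ℝ).prod volume) := by
    refine (MeasurePreserving.id volume).skew_product (g := fun t y => y + ξ * t) ?_ ?_
    · change Measurable fun p : ℝ × ℝ => p.2 + ξ * p.1
      fun_prop
    · exact ae_of_all _ fun t => (measurePreserving_add_right volume (ξ * t)).map_eq
  exact (Measure.measurePreserving_swap.comp h1).comp Measure.measurePreserving_swap

/-- The fundamental theorem of calculus on each half-line: the distributional derivative of a step
function is its jump times a Dirac mass. -/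
lemma integral_step_mul_deriv {η : ℝ → ℝ} (hη : ContDiff ℝ 1 η) (hc : HasCompactSupport η)
    (Cm Cp : ℝ) :
    Integrable (fun y => (if y < 0 then Cm else Cp) * deriv η y) ∧
    ∫ y, (if y < 0 then Cm else Cp) * deriv η y = (Cm - Cp) * η 0 := by
  have hi : Integrable (deriv η) :=
    (hη.continuous_deriv le_rfl).integrable_of_hasCompactSupport hc.deriv
  have hI : Integrable (fun y => (if y < 0 then Cm else Cp) * deriv η y) := by
    refine hi.bdd_mul (c := max |Cm| |Cp|) ?_ ?_
    · exact (Measurable.ite measurableSet_Iio measurable_const measurable_const).aestronglyMeasurable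
    · refine ae_of_all _ fun y => ?_
      split_ifs <;> simp
  refine ⟨hI, ?_⟩
  rw [← intervalIntegral.integral_Iic_add_Ioi (b := 0) hI.integrableOn hI.integrableOn,
    integral_Iic_eq_integral_Iio,
    setIntegral_congr_fun (g := fun y => Cm * deriv η y) measurableSet_Iio
      (fun y hy => by simp [mem_Iio.1 hy]),
    setIntegral_congr_fun (s := Ioi 0) (g := fun y => Cp * deriv η y) measurableSet_Ioi
      (fun y hy => by simp [not_lt.2 (mem_Ioi.1 hy).le]),
    integral_const_mul, integral_const_mul, ← integral_Iic_eq_integral_Iio,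
    hc.integral_Iic_deriv_eq hη, hc.integral_Ioi_deriv_eq hη]
  ring

/-- Rankine–Hugoniot relation for a self-similar balance law, at a speed `ξ` with constant states
on both sides. -/
theorem SelfSimilarBalance.rankine_hugoniot {A B : ℝ → ℝ} {c σ : ℝ}
    (h : SelfSimilarBalance A B c σ) {ξ Am Ap Bm Bp : ℝ}
    (hAm : ∀ᶠ x in 𝓝[<] ξ, A x = Am) (hAp : ∀ᶠ x in 𝓝[>] ξ, A x = Ap)
    (hBm : ∀ᶠ x in 𝓝[<] ξ, B x = Bm) (hBp : ∀ᶠ x in 𝓝[>] ξ, B x = Bp) :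
    (Bp - ξ * Ap) - (Bm - ξ * Am) = if ξ = σ then c else 0 := by
  obtain ⟨l, hl, hlm⟩ := mem_nhdsLT_iff_exists_Ioo_subset.1 (hAm.and hBm)
  obtain ⟨u, hu, hup⟩ := mem_nhdsGT_iff_exists_Ioo_subset.1 (hAp.and hBp)
  simp only [mem_Iio, mem_Ioi] at hl hu
  -- The test function will live in `|x - ξt| ≤ r`, `1 ≤ t ≤ 2`. Since `t ≥ 1`, `x/t` stays within
  -- `r` of `ξ`, where the profile has constant one-sided values. The bound `r ≤ |σ - ξ|` keeps the
  -- ray `x = σt` away from the positive values of the test function.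
  obtain ⟨r, hr0, hrl, hru, hrs⟩ : ∃ r, 0 < r ∧ r ≤ ξ - l ∧ r ≤ u - ξ ∧ (ξ ≠ σ → r ≤ |σ - ξ|) := by
    by_cases hs : ξ = σ
    · exact ⟨min (ξ - l) (u - ξ), lt_min (by linarith) (by linarith), min_le_left _ _,
        min_le_right _ _, fun h => absurd hs h⟩
    · exact ⟨min (min (ξ - l) (u - ξ)) |σ - ξ|,
        lt_min (lt_min (by linarith) (by linarith)) (abs_pos.2 (sub_ne_zero.2 (Ne.symm hs))),
        (min_le_left _ _).trans (min_le_left _ _), (min_le_left _ _).trans (min_le_right _ _),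
        fun _ => min_le_right _ _⟩
  let η : ContDiffBump (0 : ℝ) := ⟨r / 2, r, by positivity, by linarith⟩
  let χ : ContDiffBump (3 / 2 : ℝ) := ⟨1 / 4, 1 / 2, by norm_num, by norm_num⟩
  have hη0 : η 0 = 1 := η.one_of_mem_closedBall (by simp [η]; positivity)
  have hηsupp : ∀ y, r ≤ |y| → η y = 0 := fun y hy =>
    η.zero_of_le_dist (by simpa [Real.dist_eq, η] using hy)
  have hχsupp : ∀ t, t ∉ Ioo (1 : ℝ) 2 → χ t = 0 := fun t ht => by
    refine χ.zero_of_le_dist ?_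
    by_contra hlt
    rw [not_le, Real.dist_eq] at hlt
    have := abs_lt.1 hlt
    simp only [χ] at this
    exact ht ⟨by linarith [this.1], by linarith [this.2]⟩
  have hηd : ContDiff ℝ ∞ η := η.contDiff
  have hχd : ContDiff ℝ ∞ χ := χ.contDiff
  have hηc : HasCompactSupport η := η.hasCompactSupport
  have hχc : HasCompactSupport χ := χ.hasCompactSupport
  have hηd0 : ∀ y, r < |y| → deriv η y = 0 := fun y hy => by
    have : η =ᶠ[𝓝 y] fun _ => 0 := by
      filter_upwards [continuous_abs.continuousAt.eventually (lt_mem_nhds hy)] with z hz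
      exact hηsupp z (le_of_lt hz)
    rw [this.deriv_eq]; simp
  have hχd0 : ∀ t, t ∉ Icc (1 : ℝ) 2 → deriv χ t = 0 := fun t ht => by
    have : χ =ᶠ[𝓝 t] fun _ => 0 := by
      filter_upwards [isClosed_Icc.isOpen_compl.mem_nhds ht] with z hz
      exact hχsupp z (fun hh => hz (Ioo_subset_Icc_self hh))
    rw [this.deriv_eq]; simp
  let φ : ℝ × ℝ → ℝ := fun q => η (q.1 - ξ * q.2) * χ q.2
  have hφd : ContDiff ℝ ∞ φ := by
    have h1 : ContDiff ℝ ∞ fun q : ℝ × ℝ => q.1 - ξ * q.2 := by fun_prop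
    exact (hηd.comp h1).mul (hχd.comp contDiff_snd)
  have hφsupp : ∀ q : ℝ × ℝ, φ q ≠ 0 → |q.1 - ξ * q.2| ≤ r ∧ q.2 ∈ Icc (1 : ℝ) 2 := by
    intro q hq
    constructor
    · by_contra hlt
      exact hq (by simp [φ, hηsupp _ (not_le.1 hlt).le])
    · by_contra hlt
      exact hq (by simp [φ, hχsupp _ (fun hh => hlt (Ioo_subset_Icc_self hh))])
  have hφc : HasCompactSupport φ := by
    refine HasCompactSupport.intro
      (isCompact_Icc.prod isCompact_Icc : IsCompact (Icc (-(r + 2 * |ξ|)) (r + 2 * |ξ|) ×ˢ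
        Icc (1 : ℝ) 2)) fun q hq => ?_
    by_contra hne
    obtain ⟨h1, h2⟩ := hφsupp q hne
    refine hq ⟨?_, h2⟩
    have h3 : |ξ * q.2| ≤ 2 * |ξ| := by
      rw [abs_mul, abs_of_pos (by linarith [h2.1] : 0 < q.2)]
      nlinarith [abs_nonneg ξ, h2.2]
    have := abs_le.1 h1
    have := abs_le.1 h3
    constructor <;> linarith
  have hφt : tsupport φ ⊆ {q | 0 < q.2} := by
    have : tsupport φ ⊆ {q : ℝ × ℝ | 1 ≤ q.2} :=
      closure_minimal (fun q hq => (hφsupp q hq).2.1)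
        (isClosed_le continuous_const continuous_snd)
    exact fun q hq => lt_of_lt_of_le (one_pos : (0 : ℝ) < 1) (this hq)
  have key := h φ hφd hφc hφt
  have hfd : ∀ q : ℝ × ℝ, HasFDerivAt φ
      (η (q.1 - ξ * q.2) • (deriv χ q.2 • ContinuousLinearMap.snd ℝ ℝ ℝ)
        + χ q.2 • (deriv η (q.1 - ξ * q.2) •
          (ContinuousLinearMap.fst ℝ ℝ ℝ - ξ • ContinuousLinearMap.snd ℝ ℝ ℝ))) q := by
    intro q
    have h1 : HasFDerivAt (fun q : ℝ × ℝ => q.1 - ξ * q.2)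
        (ContinuousLinearMap.fst ℝ ℝ ℝ - ξ • ContinuousLinearMap.snd ℝ ℝ ℝ) q :=
      hasFDerivAt_fst.sub (hasFDerivAt_snd.const_mul ξ)
    have h2 := ((hηd.differentiable (by simp)) (q.1 - ξ * q.2)).hasDerivAt.comp_hasFDerivAt q h1
    have h3 := ((hχd.differentiable (by simp)) q.2).hasDerivAt.comp_hasFDerivAt q
      (hasFDerivAt_snd (𝕜 := ℝ) (E := ℝ) (F := ℝ) (p := q))
    exact h2.mul h3
  have hstep : ∫ q : ℝ × ℝ, (A (q.1 / q.2) * fderiv ℝ φ q (0, 1)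
      + B (q.1 / q.2) * fderiv ℝ φ q (1, 0)) =
      ∫ q : ℝ × ℝ, (((if q.1 < 0 then Bm - ξ * Am else Bp - ξ * Ap) * deriv η q.1) * χ q.2
        + ((if q.1 < 0 then Am else Ap) * η q.1) * deriv χ q.2) := by
    -- In the coordinate `y = x - ξt` the time derivative becomes `-ξ η' χ + η χ'`, so `η'` gets the
    -- coefficient `B - ξA`. The profile is a step in `y`, except on the null set `y = 0`.
    rw [← (measurePreserving_shear ξ).integral_comp']
    refine integral_congr_ae ?_
    have h0 : ∀ᵐ q : ℝ × ℝ, q.1 ≠ 0 :=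
      (Measure.quasiMeasurePreserving_fst (μ := (volume : Measure ℝ))
        (ν := (volume : Measure ℝ))).ae (Measure.ae_ne volume 0)
    filter_upwards [h0] with q hq0
    rw [(hfd _).fderiv, shear_apply]
    simp only [add_sub_cancel_right, _root_.add_apply, _root_.smul_apply,
      ContinuousLinearMap.coe_snd', _root_.sub_apply, ContinuousLinearMap.coe_fst',
      smul_eq_mul, mul_one, mul_zero, zero_sub, zero_add, sub_zero]
    by_cases ht : q.2 ∈ Icc (1 : ℝ) 2
    swap
    · simp [hχsupp _ (fun hh => ht (Ioo_subset_Icc_self hh)), hχd0 _ ht]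
    by_cases hy : r ≤ |q.1|
    · by_cases ht1 : q.2 ∈ Ioo (1 : ℝ) 2
      · rcases hy.lt_or_eq with hy' | hy'
        · simp [hηsupp _ hy, hηd0 _ hy']
        -- On the edge `|y| = r` the bump attains its minimum `0`, so its derivative vanishes there
        -- too.
        · have hd : deriv η q.1 = 0 := by
            refine IsLocalMin.deriv_eq_zero ?_
            refine Eventually.of_forall fun z => ?_
            rw [hηsupp _ hy]
            exact η.nonneg
          simp [hηsupp _ hy, hd]
      · have hχ0 := hχsupp _ ht1
        simp [hηsupp _ hy, hχ0]
    · rw [not_le] at hy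
      have ht0 : 0 < q.2 := by linarith [ht.1]
      have hdiv : (q.1 + ξ * q.2) / q.2 = ξ + q.1 / q.2 := by field_simp; ring
      have hb := abs_lt.1 hy
      rcases lt_or_gt_of_ne hq0 with hneg | hpos
      · have hm : (q.1 + ξ * q.2) / q.2 ∈ Ioo l ξ := by
          rw [hdiv]
          have h1 : q.1 / q.2 < 0 := div_neg_of_neg_of_pos hneg ht0
          have h2 : q.1 ≤ q.1 / q.2 := by
            rw [le_div_iff₀ ht0]; nlinarith [ht.1]
          constructor <;> linarith
        obtain ⟨hA, hB⟩ := hlm hm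
        rw [hA, hB, if_pos hneg, if_pos hneg]
        ring
      · have hm : (q.1 + ξ * q.2) / q.2 ∈ Ioo ξ u := by
          rw [hdiv]
          have h1 : 0 < q.1 / q.2 := div_pos hpos ht0
          have h2 : q.1 / q.2 ≤ q.1 := by
            rw [div_le_iff₀ ht0]; nlinarith [ht.1]
          constructor <;> linarith
        obtain ⟨hA, hB⟩ := hup hm
        rw [hA, hB, if_neg (not_lt.2 hpos.le), if_neg (not_lt.2 hpos.le)]
        ring
  obtain ⟨hi1, he1⟩ := integral_step_mul_deriv (hηd.of_le (by simp)) hηc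
    (Bm - ξ * Am) (Bp - ξ * Ap)
  have hi2 : Integrable fun y => (if y < 0 then Am else Ap) * η y := by
    refine (η.continuous.integrable_of_hasCompactSupport hηc).bdd_mul (c := max |Am| |Ap|) ?_ ?_
    · exact (Measurable.ite measurableSet_Iio measurable_const measurable_const).aestronglyMeasurable
    · refine ae_of_all _ fun y => ?_
      split_ifs <;> simp
  have hχi : Integrable χ := χ.continuous.integrable_of_hasCompactSupport hχc
  have hχi' : Integrable (deriv χ) :=
    (hχd.continuous_deriv (by simp)).integrable_of_hasCompactSupport hχc.deriv
  -- The terms with `η χ'` drop out, and only the jump of `B - ξA` remains.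
  have hχ'0 : ∫ t, deriv χ t = 0 := integral_eq_zero_of_hasDerivAt_of_integrable
    (fun t => ((hχd.differentiable (by simp)) t).hasDerivAt) hχi' hχi
  have hlhs : ∫ q : ℝ × ℝ, (((if q.1 < 0 then Bm - ξ * Am else Bp - ξ * Ap) * deriv η q.1) * χ q.2
        + ((if q.1 < 0 then Am else Ap) * η q.1) * deriv χ q.2)
      = ((Bm - ξ * Am) - (Bp - ξ * Ap)) * ∫ t, χ t := by
    rw [Measure.volume_eq_prod, integral_add (hi1.mul_prod hχi) (hi2.mul_prod hχi')]
    rw [integral_prod_mul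
        (fun y => (if y < 0 then Bm - ξ * Am else Bp - ξ * Ap) * deriv η y) (fun t => χ t),
      integral_prod_mul (fun y => (if y < 0 then Am else Ap) * η y) (deriv χ), he1, hη0, hχ'0]
    ring
  have hrhs : ∫ t in Ioi (0 : ℝ), φ (σ * t, t) = if ξ = σ then ∫ t, χ t else 0 := by
    split_ifs with hs
    · subst hs
      have : ∫ t in Ioi (0 : ℝ), χ t = ∫ t, χ t := by
        refine setIntegral_eq_integral_of_forall_compl_eq_zero fun t ht => hχsupp t fun hh => ht ?_
        exact lt_trans one_pos hh.1
      rw [← this]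
      refine setIntegral_congr_fun measurableSet_Ioi fun t _ => ?_
      simp [φ, hη0]
    · refine integral_eq_zero_of_ae (ae_of_all _ fun t => ?_)
      by_cases ht : t ∈ Ioo (1 : ℝ) 2
      · have : η (σ * t - ξ * t) = 0 := by
          refine hηsupp _ ((hrs hs).trans ?_)
          rw [← sub_mul, abs_mul, abs_of_pos (by linarith [ht.1] : 0 < t)]
          nlinarith [abs_nonneg (σ - ξ), ht.1]
        simp [φ, this]
      · simp [φ, hχsupp t ht]
  rw [hstep, hlhs, hrhs] at key
  have hpos : 0 < ∫ t, χ t := χ.integral_pos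
  split_ifs at key ⊢ with hs
  · have : ((Bp - ξ * Ap) - (Bm - ξ * Am) - c) * ∫ t, χ t = 0 := by linarith
    rcases mul_eq_zero.1 this with h1 | h1
    · linarith
    · exact absurd h1 hpos.ne'
  · have : ((Bp - ξ * Ap) - (Bm - ξ * Am)) * ∫ t, χ t = 0 := by linarith
    rcases mul_eq_zero.1 this with h1 | h1
    · linarith
    · exact absurd h1 hpos.ne'

/-! ### Piecewise constant functions of one variable. -/

/-- `f` is constant on every interval that avoids `S`. -/
def ConstOff {α : Type*} (S : Finset ℝ) (f : ℝ → α) : Prop :=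
  ∀ ξ η, ξ ≤ η → (∀ σ ∈ S, σ ∉ Icc ξ η) → f ξ = f η

lemma exists_lt_forall_notMem_Ioo (S : Finset ℝ) (ξ : ℝ) :
    ∃ l < ξ, ∀ σ ∈ S, σ ∉ Ioo l ξ := by
  have h : ∀ᶠ x in 𝓝[<] ξ, x ∉ S := by
    have : ((S : Set ℝ) \ {ξ})ᶜ ∈ 𝓝 ξ :=
      (S.finite_toSet.subset sdiff_subset).isClosed.isOpen_compl.mem_nhds (by simp)
    filter_upwards [mem_nhdsWithin_of_mem_nhds this, self_mem_nhdsWithin] with x hx hlt hxS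
    exact hx ⟨hxS, (mem_Iio.1 hlt).ne⟩
  obtain ⟨l, hl, hs⟩ := mem_nhdsLT_iff_exists_Ioo_subset.1 h
  exact ⟨l, hl, fun σ hσ hm => hs hm hσ⟩

lemma exists_gt_forall_notMem_Ioo (S : Finset ℝ) (ξ : ℝ) :
    ∃ u > ξ, ∀ σ ∈ S, σ ∉ Ioo ξ u := by
  have h : ∀ᶠ x in 𝓝[>] ξ, x ∉ S := by
    have : ((S : Set ℝ) \ {ξ})ᶜ ∈ 𝓝 ξ :=
      (S.finite_toSet.subset sdiff_subset).isClosed.isOpen_compl.mem_nhds (by simp)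
    filter_upwards [mem_nhdsWithin_of_mem_nhds this, self_mem_nhdsWithin] with x hx hlt hxS
    exact hx ⟨hxS, (mem_Ioi.1 hlt).ne'⟩
  obtain ⟨l, hl, hs⟩ := mem_nhdsGT_iff_exists_Ioo_subset.1 h
  exact ⟨l, hl, fun σ hσ hm => hs hm hσ⟩

namespace ConstOff

variable {α β : Type*} {S : Finset ℝ} {f : ℝ → α}

lemma comp (h : ConstOff S f) (Φ : α → β) : ConstOff S (fun ξ => Φ (f ξ)) :=
  fun ξ η hle hs => congrArg Φ (h ξ η hle hs)

lemma exists_left (h : ConstOff S f) (ξ : ℝ) :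
    ∃ ζ < ξ, ζ ∉ S ∧ ∀ᶠ η in 𝓝[<] ξ, f η = f ζ := by
  obtain ⟨l, hl, hs⟩ := exists_lt_forall_notMem_Ioo S ξ
  obtain ⟨ζ, h1, h2⟩ := exists_between hl
  refine ⟨ζ, h2, fun hm => hs _ hm ⟨h1, h2⟩, ?_⟩
  filter_upwards [Ioo_mem_nhdsLT hl] with η hη
  rcases le_total η ζ with hle | hle
  · exact h _ _ hle fun σ hσ hm => hs σ hσ ⟨hη.1.trans_le hm.1, hm.2.trans_lt h2⟩
  · exact (h _ _ hle fun σ hσ hm => hs σ hσ ⟨h1.trans_le hm.1, hm.2.trans_lt hη.2⟩).symm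

lemma exists_right (h : ConstOff S f) (ξ : ℝ) :
    ∃ ζ > ξ, ζ ∉ S ∧ ∀ᶠ η in 𝓝[>] ξ, f η = f ζ := by
  obtain ⟨u, hu, hs⟩ := exists_gt_forall_notMem_Ioo S ξ
  obtain ⟨ζ, h1, h2⟩ := exists_between hu
  refine ⟨ζ, h1, fun hm => hs _ hm ⟨h1, h2⟩, ?_⟩
  filter_upwards [Ioo_mem_nhdsGT hu] with η hη
  rcases le_total η ζ with hle | hle
  · exact h _ _ hle fun σ hσ hm => hs σ hσ ⟨hη.1.trans_le hm.1, hm.2.trans_lt h2⟩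
  · exact (h _ _ hle fun σ hσ hm => hs σ hσ ⟨h1.trans_le hm.1, hm.2.trans_lt hη.2⟩).symm

lemma eventually_eq (h : ConstOff S f) {ξ : ℝ} (hξ : ξ ∉ S) : ∀ᶠ η in 𝓝 ξ, f η = f ξ := by
  obtain ⟨l, hl, hsl⟩ := exists_lt_forall_notMem_Ioo S ξ
  obtain ⟨u, hu, hsu⟩ := exists_gt_forall_notMem_Ioo S ξ
  have hs : ∀ σ ∈ S, σ ∉ Ioo l u := fun σ hσ hm => by
    rcases lt_trichotomy σ ξ with h1 | h1 | h1
    · exact hsl σ hσ ⟨hm.1, h1⟩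
    · exact hξ (h1 ▸ hσ)
    · exact hsu σ hσ ⟨h1, hm.2⟩
  filter_upwards [Ioo_mem_nhds hl hu] with η hη
  rcases le_total η ξ with hle | hle
  · exact h _ _ hle fun σ hσ hm => hs σ hσ ⟨hη.1.trans_le hm.1, hm.2.trans_lt hu⟩
  · exact (h _ _ hle fun σ hσ hm => hs σ hσ ⟨hl.trans_le hm.1, hm.2.trans_lt hη.2⟩).symm

lemma locallyIntegrable {A : ℝ → ℝ} (h : ConstOff S A) : LocallyIntegrable A volume := by
  intro ξ
  obtain ⟨ζ, -, -, hl⟩ := h.exists_left ξ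
  obtain ⟨ζ', -, -, hr⟩ := h.exists_right ξ
  obtain ⟨l, hl, hlm⟩ := mem_nhdsLT_iff_exists_Ioo_subset.1 hl
  obtain ⟨u, hu, hup⟩ := mem_nhdsGT_iff_exists_Ioo_subset.1 hr
  have hmem : Ioo l ξ ∪ ({ξ} ∪ Ioo ξ u) ∈ 𝓝 ξ := by
    filter_upwards [Ioo_mem_nhds hl hu] with η hη
    rcases lt_trichotomy η ξ with h1 | h1 | h1
    · exact Or.inl ⟨hη.1, h1⟩
    · exact Or.inr (Or.inl h1)
    · exact Or.inr (Or.inr ⟨h1, hη.2⟩)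
  refine ⟨_, hmem, ?_⟩
  rw [integrableOn_union, integrableOn_union]
  refine ⟨?_, ?_, ?_⟩
  · exact (integrableOn_const (C := A ζ) (by simp)).congr_fun (fun η hη => (hlm hη).symm)
      measurableSet_Ioo
  · exact integrableOn_singleton (hx := by rw [Real.volume_singleton]; exact ENNReal.zero_lt_top)
  · exact (integrableOn_const (C := A ζ') (by simp)).congr_fun (fun η hη => (hup hη).symm)
      measurableSet_Ioo

lemma intervalIntegrable {A : ℝ → ℝ} (h : ConstOff S A) (a b : ℝ) :
    IntervalIntegrable A volume a b :=
  (h.locallyIntegrable.integrableOn_isCompact isCompact_uIcc).intervalIntegrable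

/-- Fundamental theorem of calculus for a piecewise constant integrand and a primitive that is
known off finitely many removable singularities. -/
theorem integral_eq {A g : ℝ → ℝ} (h : ConstOff S A) {a b ga gb : ℝ} (hab : a < b)
    (hd : ∀ ξ ∈ Ioo a b, ξ ∉ S → HasDerivAt g (A ξ) ξ)
    (hc : ∀ ξ ∈ Ioo a b, ∃ v, Tendsto g (𝓝[≠] ξ) (𝓝 v))
    (ha : Tendsto g (𝓝[>] a) (𝓝 ga)) (hb : Tendsto g (𝓝[<] b) (𝓝 gb)) :
    ∫ ξ in a..b, A ξ = gb - ga := by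
  -- The values of `g` on `S` are arbitrary, so `g` is replaced by its continuous extension from the
  -- dense set `D`. A finite exceptional set is harmless for the fundamental theorem of calculus.
  set D : Set ℝ := Ioo a b ∩ (S : Set ℝ)ᶜ with hD
  have hDo : IsOpen D := isOpen_Ioo.inter S.finite_toSet.isClosed.isOpen_compl
  have hcl : Icc a b ⊆ closure D := by
    rw [← closure_Ioo hab.ne]
    refine closure_minimal ?_ isClosed_closure
    exact (S.countable_toSet.dense_compl ℝ).open_subset_closure_inter isOpen_Ioo
  have hta : Tendsto g (𝓝[D] a) (𝓝 ga) :=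
    ha.mono_left (nhdsWithin_mono _ fun x hx => hx.1.1)
  have htb : Tendsto g (𝓝[D] b) (𝓝 gb) :=
    hb.mono_left (nhdsWithin_mono _ fun x hx => hx.1.2)
  have hFg : ∀ ξ ∈ D, extendFrom D g ξ = g ξ := fun ξ hξ =>
    extendFrom_eq (subset_closure hξ)
      ((hd ξ hξ.1 hξ.2).continuousAt.tendsto.mono_left nhdsWithin_le_nhds)
  have hFc : ContinuousOn (extendFrom D g) (Icc a b) := by
    refine continuousOn_extendFrom hcl fun x hx => ?_
    rcases hx.1.eq_or_lt with rfl | h1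
    · exact ⟨_, hta⟩
    rcases hx.2.eq_or_lt with rfl | h2
    · exact ⟨_, htb⟩
    by_cases hxS : x ∈ S
    · obtain ⟨v, hv⟩ := hc x ⟨h1, h2⟩
      exact ⟨v, hv.mono_left (nhdsWithin_mono _ fun y hy hyx => hy.2 (by
        rw [mem_singleton_iff] at hyx; rw [hyx]; exact hxS))⟩
    · exact ⟨_, (hd x ⟨h1, h2⟩ hxS).continuousAt.tendsto.mono_left nhdsWithin_le_nhds⟩
  rw [integral_eq_of_hasDerivAt_off_countable_of_le (extendFrom D g) A hab.le
    (s := (S : Set ℝ)) S.countable_toSet hFc (fun x hx => ?_) (h.intervalIntegrable a b),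
    extendFrom_eq (hcl (left_mem_Icc.2 hab.le)) hta,
    extendFrom_eq (hcl (right_mem_Icc.2 hab.le)) htb]
  refine (hd x hx.1 hx.2).congr_of_eventuallyEq ?_
  filter_upwards [hDo.mem_nhds hx] with y hy using hFg y hy

/-- A piecewise constant function without jumps is constant. -/
theorem eq_of_forall_jump_eq {A : ℝ → ℝ} (h : ConstOff S A) {a b : ℝ} (hab : a ≤ b)
    (ha : a ∉ S) (hb : b ∉ S)
    (hj : ∀ ξ ∈ Ioo a b, ∃ v, (∀ᶠ η in 𝓝[<] ξ, A η = v) ∧ ∀ᶠ η in 𝓝[>] ξ, A η = v) :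
    A a = A b := by
  rcases hab.eq_or_lt with rfl | hlt
  · rfl
  -- `A` itself serves as a primitive of `0`, its singularities being removable because there are no
  -- jumps.
  have hz : ConstOff S fun _ : ℝ => (0 : ℝ) := fun _ _ _ _ => rfl
  have hev : ∀ ξ ∉ S, A =ᶠ[𝓝 ξ] fun _ => A ξ := fun ξ hξ => h.eventually_eq hξ
  have := hz.integral_eq (g := A) (ga := A a) (gb := A b) hlt
    (fun ξ _ hξ => (hasDerivAt_const ξ (A ξ)).congr_of_eventuallyEq (hev ξ hξ))
    (fun ξ hξ => by
      obtain ⟨v, hl, hr⟩ := hj ξ hξ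
      refine ⟨v, ?_⟩
      rw [← Iio_union_Ioi, nhdsWithin_union]
      exact (tendsto_const_nhds.congr' (hl.mono fun _ h => h.symm)).sup
        (tendsto_const_nhds.congr' (hr.mono fun _ h => h.symm)))
    ((tendsto_const_nhds.congr' ((hev a ha).symm)).mono_left nhdsWithin_le_nhds)
    ((tendsto_const_nhds.congr' ((hev b hb).symm)).mono_left nhdsWithin_le_nhds)
  simp only [intervalIntegral.integral_zero] at this
  linarith

end ConstOff

/-! ### Integrated balance laws. -/

/-- Integrated form of a self-similar balance law over `(a, b)`. -/
theorem SelfSimilarBalance.integral_eq {S : Finset ℝ} {A B : ℝ → ℝ} {c σ : ℝ}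
    (h : SelfSimilarBalance A B c σ) (hA : ConstOff S A) (hB : ConstOff S B)
    {a b Aa Ba Ab Bb : ℝ} (hab : a < b)
    (hAa : ∀ᶠ x in 𝓝[>] a, A x = Aa) (hBa : ∀ᶠ x in 𝓝[>] a, B x = Ba)
    (hAb : ∀ᶠ x in 𝓝[<] b, A x = Ab) (hBb : ∀ᶠ x in 𝓝[<] b, B x = Bb) :
    ∫ ξ in a..b, A ξ
      = (b * Ab - Bb) - (a * Aa - Ba) + if a < σ ∧ σ < b then c else 0 := by
  -- Self-similarity turns the balance law into `(ξA - B)' = A - c δ_σ`; adding the step at `σ`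
  -- gives a primitive of `A`.
  set g : ℝ → ℝ := fun ξ => ξ * A ξ - B ξ + if σ < ξ then c else 0 with hg
  have key : ∀ (l : Filter ℝ) (ξ v w z : ℝ), l ≤ 𝓝 ξ → (∀ᶠ η in l, A η = v) →
      (∀ᶠ η in l, B η = w) → (∀ᶠ η in l, (if σ < η then c else 0) = z) →
      Tendsto g l (𝓝 (ξ * v - w + z)) := by
    intro l ξ v w z hl hv hw hz
    have : Tendsto (fun η : ℝ => η * v - w + z) l (𝓝 (ξ * v - w + z)) :=
      Continuous.tendsto' (f := fun η : ℝ => η * v - w + z) (by fun_prop) ξ _ rfl |>.mono_left hl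
    refine this.congr' ?_
    filter_upwards [hv, hw, hz] with η h1 h2 h3
    simp only [hg, h1, h2, h3]
  have hzr : ∀ ξ, ∀ᶠ η in 𝓝[>] ξ, (if σ < η then c else 0) = if σ ≤ ξ then c else 0 := by
    intro ξ
    by_cases h1 : σ ≤ ξ
    · filter_upwards [self_mem_nhdsWithin] with η hη
      rw [if_pos h1, if_pos (h1.trans_lt hη)]
    · filter_upwards [mem_nhdsWithin_of_mem_nhds (gt_mem_nhds (not_le.1 h1))] with η hη
      rw [if_neg h1, if_neg (not_lt.2 hη.le)]
  have hzl : ∀ ξ, ∀ᶠ η in 𝓝[<] ξ, (if σ < η then c else 0) = if σ < ξ then c else 0 := by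
    intro ξ
    by_cases h1 : σ < ξ
    · filter_upwards [mem_nhdsWithin_of_mem_nhds (lt_mem_nhds h1)] with η hη
      rw [if_pos h1, if_pos hη]
    · filter_upwards [self_mem_nhdsWithin] with η hη
      rw [if_neg h1, if_neg (not_lt.2 ((mem_Iio.1 hη).le.trans (not_lt.1 h1)))]
  -- The step in `g` sits at `σ`, which need not belong to `S`.
  have hA' : ConstOff (insert σ S) A := fun ξ η hle hs =>
    hA ξ η hle fun τ hτ => hs τ (Finset.mem_insert_of_mem hτ)
  rw [hA'.integral_eq (g := g) hab ?_ ?_ (key _ a _ _ _ nhdsWithin_le_nhds hAa hBa (hzr a))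
    (key _ b _ _ _ nhdsWithin_le_nhds hAb hBb (hzl b))]
  · by_cases h1 : σ ≤ a
    · rw [if_pos h1, if_pos (h1.trans_lt hab), if_neg (fun hh => not_lt.2 h1 hh.1)]
      ring
    · rw [if_neg h1]
      by_cases h2 : σ < b
      · rw [if_pos h2, if_pos ⟨not_le.1 h1, h2⟩]; ring
      · rw [if_neg h2, if_neg (fun hh => h2 hh.2)]; ring
  · intro ξ _ hξ
    rw [Finset.mem_insert, not_or] at hξ
    have hz : ∀ᶠ η in 𝓝 ξ, (if σ < η then c else 0) = if σ < ξ then c else 0 := by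
      rcases lt_or_gt_of_ne hξ.1 with h1 | h1
      · filter_upwards [gt_mem_nhds h1] with η hη
        rw [if_neg (not_lt.2 hη.le), if_neg (not_lt.2 h1.le)]
      · filter_upwards [lt_mem_nhds h1] with η hη
        rw [if_pos hη, if_pos h1]
    have hd : HasDerivAt (fun η : ℝ => η * A ξ - B ξ + if σ < ξ then c else 0) (A ξ) ξ := by
      simpa using (((hasDerivAt_id ξ).mul_const (A ξ)).sub_const (B ξ)).add_const
        (if σ < ξ then c else 0)
    refine hd.congr_of_eventuallyEq ?_
    filter_upwards [hA.eventually_eq hξ.2, hB.eventually_eq hξ.2, hz] with η h1 h2 h3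
    simp only [hg, h1, h2, h3]
  · intro ξ _
    obtain ⟨ζ, -, -, hAl⟩ := hA.exists_left ξ
    obtain ⟨ζ', -, -, hAr⟩ := hA.exists_right ξ
    obtain ⟨θ, -, -, hBl⟩ := hB.exists_left ξ
    obtain ⟨θ', -, -, hBr⟩ := hB.exists_right ξ
    -- The jump of `ξA - B` is compensated exactly by the step, so `g` has a limit at every point.
    have hRH := h.rankine_hugoniot hAl hAr hBl hBr
    refine ⟨ξ * A ζ - B θ + if σ < ξ then c else 0, ?_⟩
    rw [← Iio_union_Ioi, nhdsWithin_union]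
    refine (key _ ξ _ _ _ nhdsWithin_le_nhds hAl hBl (hzl ξ)).sup ?_
    have hr := key _ ξ _ _ _ nhdsWithin_le_nhds hAr hBr (hzr ξ)
    convert hr using 2
    rcases lt_trichotomy σ ξ with h1 | h1 | h1
    · rw [if_neg h1.ne'] at hRH
      rw [if_pos h1, if_pos h1.le]; linarith
    · rw [if_pos h1.symm] at hRH
      rw [if_neg h1.not_lt, if_pos h1.le]; linarith
    · rw [if_neg h1.ne] at hRH
      rw [if_neg (not_lt.2 h1.le), if_neg (not_le.2 h1)]; linarith

/-! ### Thermodynamics: convexity and regularity of `e(τ, s)`. -/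

lemma _root_.ConvexOn.add_hasFDerivAt_le {V : Type*} [NormedAddCommGroup V] [NormedSpace ℝ V]
    {C : Set V} {f : V → ℝ} (hf : ConvexOn ℝ C f) {x y : V} (hx : x ∈ C) (hy : y ∈ C)
    {f' : V →L[ℝ] ℝ} (hd : HasFDerivAt f f' x) : f x + f' (y - x) ≤ f y := by
  have h1 := hf.comp_affineMap (AffineMap.lineMap (k := ℝ) x y)
  have hl : HasDerivAt (fun t : ℝ => AffineMap.lineMap (k := ℝ) x y t) (y - x) 0 :=
    AffineMap.hasDerivAt_lineMap
  have hd' : HasFDerivAt f f' (AffineMap.lineMap (k := ℝ) x y 0) := by simpa using hd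
  have h2 := hd'.comp_hasDerivAt 0 hl
  have h3 := h1.le_slope_of_hasDerivAt (x := 0) (y := 1) (by simpa using hx) (by simpa using hy)
    one_pos h2
  simp only [slope_def_field, Function.comp_apply, AffineMap.lineMap_apply_one,
    AffineMap.lineMap_apply_zero, sub_zero, div_one] at h3
  linarith

namespace PhaseEOS

variable (E : PhaseEOS)

/-- The values of the entropy. -/
def entropySet : Set ℝ := {s | ∃ ρ e, (ρ, e) ∈ E.dom ∧ E.s ρ e = s}

variable {E}

/-- By `s_range` an entropy value attained at one density is attained at all densities, so the
default value in `energy` is not used. -/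
lemma energy_spec {τ s : ℝ} (hτ : 0 < τ) (hs : s ∈ E.entropySet) :
    (1 / τ, E.energy τ s) ∈ E.dom ∧ E.s (1 / τ) (E.energy τ s) = s := by
  obtain ⟨ρ, e, hd, rfl⟩ := hs
  have h := E.s_range ρ (1 / τ) (E.dom_pos _ _ hd).1 (by positivity) e hd
  rw [energy, dif_pos h]
  exact h.choose_spec

lemma energy_pos {τ s : ℝ} (hτ : 0 < τ) (hs : s ∈ E.entropySet) : 0 < E.energy τ s :=
  (E.dom_pos _ _ (energy_spec hτ hs).1).2

lemma mem_entropySet_of_energy_pos {τ s : ℝ} (h : 0 < E.energy τ s) : s ∈ E.entropySet := by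
  by_cases hh : ∃ e, (1 / τ, e) ∈ E.dom ∧ E.s (1 / τ) e = s
  · obtain ⟨e, h1, h2⟩ := hh
    exact ⟨_, e, h1, h2⟩
  · rw [energy, dif_neg hh] at h
    exact absurd h (lt_irrefl _)

/-- All entropy values already occur at density `1`, so the set is the continuous image of an
interval. This is why averaged entropies remain admissible. -/
lemma convex_entropySet : Convex ℝ E.entropySet := by
  set I : Set ℝ := {e | (1, e) ∈ E.dom}
  have hI : Convex ℝ I := fun x hx y hy a b ha hb hab => by
    have h := E.s_convex.1 (x := ((1 : ℝ), x)) (by simpa [I] using hx) (y := ((1 : ℝ), y))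
      (by simpa [I] using hy) ha hb hab
    simpa [I, hab] using h
  have himg : E.entropySet = (fun e => E.s 1 e) '' I := by
    ext s
    constructor
    · intro hs
      have := energy_spec one_pos hs
      rw [div_one] at this
      exact ⟨_, this.1, this.2⟩
    · rintro ⟨e, he, rfl⟩
      exact ⟨1, e, he, rfl⟩
  have hc : ContinuousOn (fun e => E.s 1 e) I := fun e he =>
    ((E.second_law 1 e he).continuousAt.comp (f := fun e : ℝ => ((1 : ℝ), e))
      (by fun_prop)).continuousWithinAt
  rw [himg]
  exact ((hI.isPreconnected.image _ hc).ordConnected).convex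

/-- Tangent plane inequality for the convex function `(τ, s) ↦ e(τ, s)`. -/
theorem energy_tangent_le {τ τ' s s' : ℝ} (hτ : 0 < τ) (hτ' : 0 < τ') (hs : s ∈ E.entropySet)
    (hs' : s' ∈ E.entropySet) :
    E.energy τ s - E.pressure τ s * (τ' - τ) - E.T (1 / τ) (E.energy τ s) * (s' - s)
      ≤ E.energy τ' s' := by
  obtain ⟨hd, he⟩ := energy_spec hτ hs
  obtain ⟨hd', he'⟩ := energy_spec hτ' hs'
  set e := E.energy τ s with hee
  set e' := E.energy τ' s'
  have hT := E.T_pos _ _ hd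
  have hinv : HasFDerivAt (fun x : ℝ × ℝ => (1 / x.1, x.2))
      (((-(τ ^ 2)⁻¹) • ContinuousLinearMap.fst ℝ ℝ ℝ).prod (ContinuousLinearMap.snd ℝ ℝ ℝ))
      (τ, e) := by
    refine HasFDerivAt.prodMk ?_ hasFDerivAt_snd
    have h := (hasDerivAt_inv hτ.ne').comp_hasFDerivAt (τ, e)
      (hasFDerivAt_fst (𝕜 := ℝ) (E := ℝ) (F := ℝ) (p := (τ, e)))
    refine h.congr_of_eventuallyEq (Eventually.of_forall fun x => ?_)
    simp
  have hD := (E.second_law (1 / τ) e hd).comp (τ, e) hinv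
  -- In the variables `(τ, e)` the second law reads `T ds = -(p dτ + de)`. Solving the tangent
  -- inequality of `s` for the new energy, with `T > 0`, gives the tangent inequality of `e`.
  have key := E.s_convex.convexOn.add_hasFDerivAt_le (x := (τ, e)) (y := (τ', e')) hd hd' hD
  simp only [one_div, ContinuousLinearMap.comp_apply, ContinuousLinearMap.prod_apply,
    ContinuousLinearMap.coe_fst', ContinuousLinearMap.coe_snd', _root_.smul_apply,
    _root_.sub_apply, smul_eq_mul, Prod.fst_sub, Prod.snd_sub] at key he he' hT ⊢
  rw [he, he'] at key
  have hp : E.pressure τ s = E.p τ⁻¹ e := by simp [pressure, hee]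
  rw [hp]
  generalize E.p τ⁻¹ e = P at *
  generalize E.T τ⁻¹ e = T at *
  field_simp at key
  linarith

lemma energy_antitone {τ s s' : ℝ} (hτ : 0 < τ) (hs : s ∈ E.entropySet)
    (hs' : s' ∈ E.entropySet) (h : s ≤ s') : E.energy τ s' ≤ E.energy τ s := by
  have h1 := energy_tangent_le hτ hτ hs' hs
  have h2 := E.T_pos _ _ (energy_spec hτ hs').1
  nlinarith

lemma convexOn_energy {s : ℝ} (hs : s ∈ E.entropySet) :
    ConvexOn ℝ (Ioi 0) fun τ => E.energy τ s := by
  refine ⟨convex_Ioi 0, fun x hx y hy a b ha hb hab => ?_⟩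
  have hz : 0 < a • x + b • y := convex_Ioi (0 : ℝ) hx hy ha hb hab
  have h1 := energy_tangent_le hz hx hs hs
  have h2 := energy_tangent_le hz hy hs hs
  simp only [sub_self, mul_zero, sub_zero, smul_eq_mul] at h1 h2 ⊢
  obtain rfl : b = 1 - a := by linarith
  nlinarith [mul_le_mul_of_nonneg_left h1 ha, mul_le_mul_of_nonneg_left h2 hb]

/-- Start of a bootstrap that needs no implicit function theorem: convexity in `τ` makes `e`
continuous, hence `𝒫` is continuous, hence `e` is differentiable with derivative `-𝒫`, hence `𝒫` is
differentiable because `p` is. -/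
lemma continuousAt_energy {τ s : ℝ} (hτ : 0 < τ) (hs : s ∈ E.entropySet) :
    ContinuousAt (fun τ => E.energy τ s) τ :=
  ((convexOn_energy hs).continuousOn isOpen_Ioi).continuousAt (Ioi_mem_nhds hτ)

lemma differentiableAt_p {x : ℝ × ℝ} (hx : x ∈ E.dom) :
    DifferentiableAt ℝ (fun x : ℝ × ℝ => E.p x.1 x.2) x :=
  (E.p_contDiff.contDiffAt (E.dom_open.mem_nhds hx)).differentiableAt one_ne_zero

lemma continuousAt_pressure {τ s : ℝ} (hτ : 0 < τ) (hs : s ∈ E.entropySet) :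
    ContinuousAt (fun τ => E.pressure τ s) τ := by
  have h1 : ContinuousAt (fun τ => (1 / τ, E.energy τ s)) τ :=
    (continuousAt_const.div continuousAt_id hτ.ne').prodMk (continuousAt_energy hτ hs)
  exact (differentiableAt_p (energy_spec hτ hs).1).continuousAt.comp
    (f := fun τ => (1 / τ, E.energy τ s)) h1

/-- `∂_τ e(τ, s) = -𝒫(τ, s)`. -/
theorem hasDerivAt_energy {τ s : ℝ} (hτ : 0 < τ) (hs : s ∈ E.entropySet) :
    HasDerivAt (fun τ => E.energy τ s) (-E.pressure τ s) τ := by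
  rw [hasDerivAt_iff_isLittleO, Asymptotics.isLittleO_iff]
  intro c hc
  filter_upwards [Ioi_mem_nhds hτ,
    (continuousAt_pressure hτ hs).eventually (Metric.ball_mem_nhds _ hc)] with x hx hp
  -- The tangent inequalities at `τ` and at `x` squeeze the first-order remainder between `0` and
  -- `(𝒫(τ) - 𝒫(x)) (x - τ)`.
  have h1 := energy_tangent_le hτ hx hs hs
  have h2 := energy_tangent_le hx hτ hs hs
  rw [Real.dist_eq] at hp
  simp only [sub_self, mul_zero, sub_zero, smul_eq_mul] at h1 h2 ⊢
  have h3 : |E.pressure x s - E.pressure τ s| * |x - τ| ≤ c * |x - τ| :=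
    mul_le_mul_of_nonneg_right hp.le (abs_nonneg _)
  rw [← abs_mul] at h3
  have h4 := neg_le_of_abs_le h3
  have h5 := le_of_abs_le h3
  rw [Real.norm_eq_abs, Real.norm_eq_abs, abs_le]
  constructor <;> nlinarith [abs_nonneg (x - τ)]

lemma differentiableAt_pressure {τ s : ℝ} (hτ : 0 < τ) (hs : s ∈ E.entropySet) :
    DifferentiableAt ℝ (fun τ => E.pressure τ s) τ := by
  have h1 : DifferentiableAt ℝ (fun τ => (1 / τ, E.energy τ s)) τ :=
    ((differentiableAt_const _).div differentiableAt_id hτ.ne').prodMk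
      (hasDerivAt_energy hτ hs).differentiableAt
  exact (differentiableAt_p (energy_spec hτ hs).1).comp (f := fun τ => (1 / τ, E.energy τ s)) τ h1

/-- Taylor bound for the energy under Whitham's condition. -/
theorem energy_le_of_whitham {t τ s c : ℝ} (ht : 0 < t) (hτ : 0 < τ) (hs : s ∈ E.entropySet)
    (hW : ∀ θ ∈ uIcc t τ, -deriv (fun τ => E.pressure τ s) θ < c) :
    E.energy τ s ≤ E.energy t s + E.pressure t s * (t - τ) + c * (t - τ) ^ 2 / 2 := by
  have hpos : ∀ θ ∈ uIcc t τ, 0 < θ := fun θ hθ => lt_of_lt_of_le (lt_min ht hτ) hθ.1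
  have hG : ∀ θ ∈ uIcc t τ, HasDerivAt (fun θ => -E.pressure θ s - c * θ)
      (-deriv (fun τ => E.pressure τ s) θ - c) θ := fun θ hθ => by
    exact ((differentiableAt_pressure (hpos θ hθ) hs).hasDerivAt.neg.sub
      ((hasDerivAt_id θ).const_mul c)).congr_deriv (by simp)
  have hGanti : AntitoneOn (fun θ => -E.pressure θ s - c * θ) (uIcc t τ) := by
    refine antitoneOn_of_deriv_nonpos (convex_uIcc t τ)
      (fun θ hθ => (hG θ hθ).continuousAt.continuousWithinAt)
      (fun θ hθ => (hG θ (interior_subset hθ)).differentiableAt.differentiableWithinAt)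
      fun θ hθ => ?_
    rw [(hG θ (interior_subset hθ)).deriv]
    linarith [hW θ (interior_subset hθ)]
  -- The derivative is the difference of the decreasing function `-𝒫 - cθ` between `θ` and `t`, so
  -- its sign is opposite to that of `θ - t`, and the function is largest at `θ = t`.
  have hF : ∀ θ ∈ uIcc t τ, HasDerivAt
      (fun θ => E.energy θ s - E.pressure t s * (t - θ) - c * (t - θ) ^ 2 / 2)
      ((-E.pressure θ s - c * θ) - (-E.pressure t s - c * t)) θ := fun θ hθ => by
    have h1 := (hasDerivAt_id θ).const_sub t
    have h2 := ((hasDerivAt_energy (hpos θ hθ) hs).sub (h1.const_mul (E.pressure t s))).sub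
      (((h1.pow 2).const_mul c).div_const 2)
    refine h2.congr_deriv ?_
    simp
    ring
  have hFc : ContinuousOn
      (fun θ => E.energy θ s - E.pressure t s * (t - θ) - c * (t - θ) ^ 2 / 2) (uIcc t τ) :=
    fun θ hθ => (hF θ hθ).continuousAt.continuousWithinAt
  suffices h : E.energy τ s - E.pressure t s * (t - τ) - c * (t - τ) ^ 2 / 2
      ≤ E.energy t s - E.pressure t s * (t - t) - c * (t - t) ^ 2 / 2 by
    simp only [sub_self, mul_zero, sub_zero, ne_eq, OfNat.ofNat_ne_zero, not_false_eq_true,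
      zero_pow, zero_div] at h
    linarith
  rcases le_total t τ with hle | hle
  · refine antitoneOn_of_deriv_nonpos (convex_uIcc t τ) hFc
      (fun θ hθ => (hF θ (interior_subset hθ)).differentiableAt.differentiableWithinAt)
      (fun θ hθ => ?_) left_mem_uIcc right_mem_uIcc hle
    rw [(hF θ (interior_subset hθ)).deriv]
    have h1 := interior_subset hθ
    have h2 := hGanti left_mem_uIcc h1 (by rw [uIcc_of_le hle] at h1; exact h1.1)
    simp only at h2
    linarith
  · refine monotoneOn_of_deriv_nonneg (convex_uIcc t τ) hFc
      (fun θ hθ => (hF θ (interior_subset hθ)).differentiableAt.differentiableWithinAt)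
      (fun θ hθ => ?_) right_mem_uIcc left_mem_uIcc hle
    rw [(hF θ (interior_subset hθ)).deriv]
    have h1 := interior_subset hθ
    have h2 := hGanti h1 left_mem_uIcc (by rw [uIcc_of_ge hle] at h1; exact h1.2)
    simp only at h2
    linarith

/-- For a stiffened gas the sign of `ρ e - p_∞` depends on the entropy only. -/
theorem IsStiffenedGas.pos_of_pos {γ q : ℝ} (h : E.IsStiffenedGas γ q) {τ τ' s : ℝ}
    (hτ : 0 < τ) (hτ' : 0 < τ') (hs : s ∈ E.entropySet) (hpos : 0 < 1 / τ * E.energy τ s - q) :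
    0 < 1 / τ' * E.energy τ' s - q := by
  -- The isentropic invariant: `(ρe - p_∞) τ^γ` is constant in `τ` at fixed entropy, since `∂_τ e =
  -- -𝒫`.
  have hd : ∀ θ : ℝ, 0 < θ →
      HasDerivAt (fun θ => (1 / θ * E.energy θ s - q) * θ ^ γ) 0 θ := by
    intro θ hθ
    have h1 := ((hasDerivAt_inv hθ.ne').mul (hasDerivAt_energy hθ hs)).sub_const q
    have h2 := h1.mul (Real.hasDerivAt_rpow_const (p := γ) (Or.inl hθ.ne'))
    have hp : E.pressure θ s = (γ - 1) * (1 / θ) * E.energy θ s - γ * q :=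
      h.2.2 _ _ (energy_spec hθ hs).1
    have h3 : HasDerivAt (fun θ => (1 / θ * E.energy θ s - q) * θ ^ γ) _ θ :=
      h2.congr_of_eventuallyEq (Eventually.of_forall fun x => by simp)
    refine h3.congr_deriv ?_
    simp only [hp, Real.rpow_sub_one hθ.ne', Pi.mul_apply]
    field_simp
    ring
  have hconst : (1 / τ * E.energy τ s - q) * τ ^ γ = (1 / τ' * E.energy τ' s - q) * τ' ^ γ :=
    (convex_Ioi (0 : ℝ)).is_const_of_fderivWithin_eq_zero (𝕜 := ℝ)
      (f := fun θ => (1 / θ * E.energy θ s - q) * θ ^ γ)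
      (fun θ hθ => (hd θ hθ).differentiableAt.differentiableWithinAt)
      (fun θ hθ => by
        rw [fderivWithin_of_isOpen isOpen_Ioi hθ, (hd θ hθ).hasFDerivAt.fderiv]
        ext
        simp) hτ hτ'
  have h1 : 0 < (1 / τ' * E.energy τ' s - q) * τ' ^ γ :=
    hconst ▸ mul_pos hpos (Real.rpow_pos_of_pos hτ γ)
  exact pos_of_mul_pos_left h1 (Real.rpow_pos_of_pos hτ' γ).le

end PhaseEOS

/-! ### One-sided limits of piecewise constant functions -/

namespace ConstOff

variable {α : Type*} [TopologicalSpace α] [T2Space α] {S : Finset ℝ} {f : ℝ → α}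

lemma exists_leftLim (h : ConstOff S f) (ξ : ℝ) : ∃ ζ ∉ S, Function.leftLim f ξ = f ζ := by
  obtain ⟨ζ, -, hS, hev⟩ := h.exists_left ξ
  exact ⟨ζ, hS, leftLim_eq_of_tendsto (tendsto_const_nhds.congr' (hev.mono fun _ h => h.symm))⟩

lemma exists_rightLim (h : ConstOff S f) (ξ : ℝ) : ∃ ζ ∉ S, Function.rightLim f ξ = f ζ := by
  obtain ⟨ζ, -, hS, hev⟩ := h.exists_right ξ
  exact ⟨ζ, hS, rightLim_eq_of_tendsto (tendsto_const_nhds.congr' (hev.mono fun _ h => h.symm))⟩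

lemma eventually_leftLim (h : ConstOff S f) (ξ : ℝ) :
    ∀ᶠ η in 𝓝[<] ξ, f η = Function.leftLim f ξ := by
  obtain ⟨ζ, -, -, hev⟩ := h.exists_left ξ
  rwa [leftLim_eq_of_tendsto (tendsto_const_nhds.congr' (hev.mono fun _ h => h.symm))]

lemma eventually_rightLim (h : ConstOff S f) (ξ : ℝ) :
    ∀ᶠ η in 𝓝[>] ξ, f η = Function.rightLim f ξ := by
  obtain ⟨ζ, -, -, hev⟩ := h.exists_right ξ
  rwa [rightLim_eq_of_tendsto (tendsto_const_nhds.congr' (hev.mono fun _ h => h.symm))]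

end ConstOff

lemma ae_notMem_finset (S : Finset ℝ) : ∀ᵐ ξ : ℝ, ξ ∉ S :=
  S.countable_toSet.ae_notMem volume

lemma ConstOff.integral_pos {S : Finset ℝ} {A : ℝ → ℝ} (h : ConstOff S A)
    (hA : ∀ ξ ∉ S, 0 < A ξ) {a b : ℝ} (hab : a < b) : 0 < ∫ ξ in a..b, A ξ := by
  -- Positivity may fail on the null set `S`; the integrand is changed there to an arbitrary
  -- positive value.
  have hae : ∀ᵐ ξ, A ξ = if ξ ∈ S then 1 else A ξ := by
    filter_upwards [ae_notMem_finset S] with ξ hξ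
    rw [if_neg hξ]
  rw [intervalIntegral.integral_congr_ae (hae.mono fun _ h _ => h)]
  refine intervalIntegral.intervalIntegral_pos_of_pos_on
    ((h.intervalIntegrable a b).congr_ae (ae_restrict_of_ae hae)) (fun ξ _ => ?_) hab
  split_ifs with hξ
  · exact one_pos
  · exact hA ξ hξ

lemma ConstOff.integral_mono {S : Finset ℝ} {A B : ℝ → ℝ} (hA : ConstOff S A)
    (hB : ConstOff S B) (h : ∀ᵐ ξ, A ξ ≤ B ξ) {a b : ℝ} (hab : a ≤ b) :
    ∫ ξ in a..b, A ξ ≤ ∫ ξ in a..b, B ξ :=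
  intervalIntegral.integral_mono_ae hab (hA.intervalIntegrable a b) (hB.intervalIntegrable a b) h

/-! ### States -/

@[simp] lemma proj_lift (U : AuxState) : proj (lift U) = U := by
  ext i; fin_cases i <;> rfl

lemma relVol_lift (U : AuxState) (k : Fin 2) : relVol (lift U) k = vol U k := by
  fin_cases k <;> simp [relVol, vol, lift, alpha, proj, mass, massIdx]

lemma sum_alpha (U : AuxState) : alpha U 0 + alpha U 1 = 1 := by simp [alpha]

lemma mass_pos_of_mem {W : RelaxState} (h : W ∈ OmegaW) (k : Fin 2) : 0 < mass (proj W) k :=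
  h.2.2.1 k

lemma alpha_pos_of_mem {W : RelaxState} (h : W ∈ OmegaW) (k : Fin 2) : 0 < alpha (proj W) k := by
  fin_cases k
  · exact h.1
  · exact sub_pos.2 h.2.1

lemma relVol_pos_of_mem {W : RelaxState} (h : W ∈ OmegaW) (k : Fin 2) : 0 < relVol W k := by
  refine div_pos ?_ (mass_pos_of_mem h k)
  fin_cases k
  · exact h.2.2.2.1
  · exact h.2.2.2.2

lemma vol_pos_of_mem {W : RelaxState} (h : W ∈ OmegaW) (k : Fin 2) : 0 < vol (proj W) k :=
  div_pos (alpha_pos_of_mem h k) (mass_pos_of_mem h k)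

variable {eos : Fin 2 → PhaseEOS}

lemma relPressure_lift (a : Fin 2 → ℝ) (U : AuxState) (k : Fin 2) :
    relPressure eos a (lift U) k = (eos k).pressure (vol U k) (spEnt U k) := by
  simp [relPressure, relVol_lift]

lemma mass_mul_relEnergy_lift (a : Fin 2 → ℝ) (U : AuxState) (k : Fin 2) :
    mass (proj (lift U)) k * relEnergy eos a (lift U) k = totEnergy eos U k := by
  simp [relEnergy, relPressure_lift, relVol_lift, totEnergy, intEnergy]

/-- At equilibrium `π_k = 𝒫_k`, whatever `a` is. Hence the fluxes of the cell state cancel between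
its two interfaces, although these use different parameters. -/
lemma momFlux_lift (a b : Fin 2 → ℝ) (U : AuxState) (k : Fin 2) :
    momFlux eos a (lift U) k = momFlux eos b (lift U) k := by
  simp [momFlux, relPressure_lift]

lemma energyFlux_lift (a b : Fin 2 → ℝ) (U : AuxState) (k : Fin 2) :
    energyFlux eos a (lift U) k = energyFlux eos b (lift U) k := by
  simp [energyFlux, relEnergy, relPressure_lift, relVol_lift]

lemma mass_mul_vel {U : AuxState} {k : Fin 2} (h : 0 < mass U k) :
    mass U k * vel U k = mom U k := by
  rw [vel]; field_simp

lemma mass_mul_spEnt {U : AuxState} {k : Fin 2} (h : 0 < mass U k) :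
    mass U k * spEnt U k = ent U k := by
  rw [spEnt]; field_simp

lemma mass_mul_vol {U : AuxState} {k : Fin 2} (h : 0 < mass U k) :
    mass U k * vol U k = alpha U k := by
  rw [vol]; field_simp

/-! ### Structure of the fan -/

namespace IsRiemannSolution

variable {a : Fin 2 → ℝ} {UL UR : AuxState} {WL WR : RelaxState} {f : Fan}

lemma exists_constOff (hf : IsRiemannSolution eos a WL WR f) :
    ∃ S : Finset ℝ, ConstOff S f.W ∧ ∀ ξ ∉ S, f.W ξ ∈ OmegaW := by
  obtain ⟨S, -, h1, h2, -⟩ := hf.piecewise_const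
  exact ⟨S, h1, h2⟩

lemma leftLim_mem (hf : IsRiemannSolution eos a WL WR f) (ξ : ℝ) :
    Function.leftLim f.W ξ ∈ OmegaW := by
  obtain ⟨S, hc, hΩ⟩ := hf.exists_constOff
  obtain ⟨ζ, hζ, he⟩ := hc.exists_leftLim ξ
  exact he ▸ hΩ ζ hζ

lemma rightLim_mem (hf : IsRiemannSolution eos a WL WR f) (ξ : ℝ) :
    Function.rightLim f.W ξ ∈ OmegaW := by
  obtain ⟨S, hc, hΩ⟩ := hf.exists_constOff
  obtain ⟨ζ, hζ, he⟩ := hc.exists_rightLim ξ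
  exact he ▸ hΩ ζ hζ

/-- Jump relation at `ξ = 0` for any of the balance laws. -/
lemma jump_zero (hf : IsRiemannSolution eos a WL WR f) {Φ Ψ : RelaxState → ℝ} {c : ℝ}
    (h : SelfSimilarBalance (fun ξ => Φ (f.W ξ)) (fun ξ => Ψ (f.W ξ)) c f.u2) :
    Ψ (Function.rightLim f.W 0) - Ψ (Function.leftLim f.W 0) = if f.u2 = 0 then c else 0 := by
  obtain ⟨S, hc, -⟩ := hf.exists_constOff
  have hl := hc.eventually_leftLim 0
  have hr := hc.eventually_rightLim 0
  have := h.rankine_hugoniot (hl.mono fun _ h => congrArg Φ h) (hr.mono fun _ h => congrArg Φ h)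
    (hl.mono fun _ h => congrArg Ψ h) (hr.mono fun _ h => congrArg Ψ h)
  simpa [eq_comm] using this

/-- Integral of a conserved quantity over the right half of the fan. -/
lemma integral_right (hf : IsRiemannSolution eos a (lift UL) (lift UR) f)
    {Φ Ψ : RelaxState → ℝ} {c : ℝ}
    (h : SelfSimilarBalance (fun ξ => Φ (f.W ξ)) (fun ξ => Ψ (f.W ξ)) c f.u2) {x : ℝ} (hx : 0 < x)
    (hR : ∀ k, vel UR k + a k * vol UR k < x) :
    ∫ ξ in (0 : ℝ)..x, Φ (f.W ξ) = x * Φ (lift UR) - Ψ (lift UR) + Ψ (Function.rightLim f.W 0)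
      + if 0 < f.u2 then c else 0 := by
  obtain ⟨S, hc, -⟩ := hf.exists_constOff
  have hr := hc.eventually_rightLim 0
  have he : ∀ᶠ ξ in 𝓝[<] x, f.W ξ = lift UR := by
    refine mem_nhdsWithin_of_mem_nhds ?_
    filter_upwards [lt_mem_nhds (hR 0), lt_mem_nhds (hR 1)] with ξ h0 h1
    refine hf.right_state ξ fun k => ?_
    rw [proj_lift]
    fin_cases k
    · exact h0
    · exact h1
  -- The `u₂*`-wave lies to the left of `x`, so its source is counted as soon as `0 < u₂*`.
  have hu : f.u2 < x := by
    have := hf.subsonic_right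
    rw [proj_lift] at this
    exact this.trans (hR 0)
  rw [h.integral_eq (hc.comp Φ) (hc.comp Ψ) hx (hr.mono fun _ h => congrArg Φ h)
    (hr.mono fun _ h => congrArg Ψ h) (he.mono fun _ h => congrArg Φ h)
    (he.mono fun _ h => congrArg Ψ h)]
  simp only [hu, and_true]
  ring

/-- Integral of a conserved quantity over the left half of the fan. -/
lemma integral_left (hf : IsRiemannSolution eos a (lift UL) (lift UR) f)
    {Φ Ψ : RelaxState → ℝ} {c : ℝ}
    (h : SelfSimilarBalance (fun ξ => Φ (f.W ξ)) (fun ξ => Ψ (f.W ξ)) c f.u2) {x : ℝ} (hx : 0 < x)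
    (hL : ∀ k, -x < vel UL k - a k * vol UL k) :
    ∫ ξ in (-x)..0, Φ (f.W ξ) = x * Φ (lift UL) + Ψ (lift UL) - Ψ (Function.leftLim f.W 0)
      + if f.u2 < 0 then c else 0 := by
  obtain ⟨S, hc, -⟩ := hf.exists_constOff
  have hl := hc.eventually_leftLim 0
  have he : ∀ᶠ ξ in 𝓝[>] (-x), f.W ξ = lift UL := by
    refine mem_nhdsWithin_of_mem_nhds ?_
    filter_upwards [gt_mem_nhds (hL 0), gt_mem_nhds (hL 1)] with ξ h0 h1
    refine hf.left_state ξ fun k => ?_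
    rw [proj_lift]
    fin_cases k
    · exact h0
    · exact h1
  have hu : -x < f.u2 := by
    have := hf.subsonic_left
    rw [proj_lift] at this
    exact (hL 0).trans this
  rw [h.integral_eq (hc.comp Φ) (hc.comp Ψ) (by linarith) (he.mono fun _ h => congrArg Φ h)
    (he.mono fun _ h => congrArg Ψ h) (hl.mono fun _ h => congrArg Φ h)
    (hl.mono fun _ h => congrArg Ψ h)]
  simp only [hu, true_and]
  ring

lemma exists_left_state (hf : IsRiemannSolution eos a WL WR f) (S : Finset ℝ) (ξ : ℝ) :
    ∃ ζ < ξ, ζ ∉ S ∧ f.W ζ = WL := by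
  have hS : ∀ᶠ ζ in atBot, ζ ∉ S := atBot_le_cofinite S.finite_toSet.compl_mem_cofinite
  obtain ⟨ζ, h1, h2, h3, h4⟩ := (((eventually_lt_atBot ξ).and (hS.and
    ((eventually_lt_atBot (vel (proj WL) 0 - a 0 * vol (proj WL) 0)).and
      (eventually_lt_atBot (vel (proj WL) 1 - a 1 * vol (proj WL) 1)))))).exists
  refine ⟨ζ, h1, h2, hf.left_state ζ fun k => ?_⟩
  fin_cases k
  · exact h3
  · exact h4

lemma exists_right_state (hf : IsRiemannSolution eos a WL WR f) (S : Finset ℝ) (ξ : ℝ) :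
    ∃ ζ > ξ, ζ ∉ S ∧ f.W ζ = WR := by
  have hS : ∀ᶠ ζ in atTop, ζ ∉ S := atTop_le_cofinite S.finite_toSet.compl_mem_cofinite
  obtain ⟨ζ, h1, h2, h3, h4⟩ := (((eventually_gt_atTop ξ).and (hS.and
    ((eventually_gt_atTop (vel (proj WR) 0 + a 0 * vol (proj WR) 0)).and
      (eventually_gt_atTop (vel (proj WR) 1 + a 1 * vol (proj WR) 1)))))).exists
  refine ⟨ζ, h1, h2, hf.right_state ζ fun k => ?_⟩
  fin_cases k
  · exact h3
  · exact h4

/-- With flux `u₂* α` the Rankine–Hugoniot relation is `(u₂* - ξ)[α] = 0`: the fraction can jump at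
`u₂*` only. -/
lemma alpha_jump (hf : IsRiemannSolution eos a WL WR f) {S : Finset ℝ} (hc : ConstOff S f.W)
    (k : Fin 2) {ξ : ℝ} (hξ : ξ ≠ f.u2) :
    ∃ v, (∀ᶠ η in 𝓝[<] ξ, alpha (proj (f.W η)) k = v) ∧
      ∀ᶠ η in 𝓝[>] ξ, alpha (proj (f.W η)) k = v := by
  have hl := (hc.eventually_leftLim ξ).mono fun _ h => congrArg (fun W => alpha (proj W) k) h
  have hr := (hc.eventually_rightLim ξ).mono fun _ h => congrArg (fun W => alpha (proj W) k) h
  have h := (hf.fraction_eq k).rankine_hugoniot hl hr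
    (hl.mono fun _ h => congrArg (f.u2 * ·) h) (hr.mono fun _ h => congrArg (f.u2 * ·) h)
  rw [ite_self] at h
  refine ⟨_, hl, ?_⟩
  have : alpha (proj (Function.rightLim f.W ξ)) k = alpha (proj (Function.leftLim f.W ξ)) k := by
    refine mul_left_cancel₀ (sub_ne_zero.2 hξ) ?_
    linarith
  exact this ▸ hr

lemma alpha_eq_left (hf : IsRiemannSolution eos a WL WR f) {S : Finset ℝ} (hc : ConstOff S f.W)
    (k : Fin 2) {ξ : ℝ} (hS : ξ ∉ S) (hξ : ξ < f.u2) :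
    alpha (proj (f.W ξ)) k = alpha (proj WL) k := by
  obtain ⟨ζ, hζ, hζS, he⟩ := hf.exists_left_state S ξ
  have := (hc.comp fun W => alpha (proj W) k).eq_of_forall_jump_eq hζ.le hζS hS
    fun η hη => hf.alpha_jump hc k (hη.2.trans hξ).ne
  simp only [he] at this
  exact this.symm

lemma alpha_eq_right (hf : IsRiemannSolution eos a WL WR f) {S : Finset ℝ} (hc : ConstOff S f.W)
    (k : Fin 2) {ξ : ℝ} (hS : ξ ∉ S) (hξ : f.u2 < ξ) :
    alpha (proj (f.W ξ)) k = alpha (proj WR) k := by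
  obtain ⟨ζ, hζ, hζS, he⟩ := hf.exists_right_state S ξ
  have := (hc.comp fun W => alpha (proj W) k).eq_of_forall_jump_eq hζ.le hS hζS
    fun η hη => hf.alpha_jump hc k (hξ.trans hη.1).ne'
  simp only [he] at this
  exact this

/-- The trace of the flux `u₂* α`, in the form that matches the indicator in `fluxPlus`. The factor
`u₂*` makes the stationary case trivial. -/
lemma alpha_rightLim_zero (hf : IsRiemannSolution eos a WL WR f) (k : Fin 2) :
    f.u2 * alpha (proj (Function.rightLim f.W 0)) k = f.u2 * alpha (proj WR) k
      - if 0 < f.u2 then f.u2 * (alpha (proj WR) k - alpha (proj WL) k) else 0 := by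
  obtain ⟨S, hc, -⟩ := hf.exists_constOff
  have hS : ∀ᶠ η in 𝓝[>] (0 : ℝ), η ∉ S := by
    obtain ⟨u, hu, hs⟩ := exists_gt_forall_notMem_Ioo S 0
    filter_upwards [Ioo_mem_nhdsGT hu] with η hη hη' using hs η hη' hη
  rcases lt_trichotomy f.u2 0 with h | h | h
  · obtain ⟨η, ⟨h1, h2⟩, h3⟩ :=
      (((hc.eventually_rightLim 0).and hS).and self_mem_nhdsWithin).exists
    rw [← h1, hf.alpha_eq_right hc k h2 (h.trans h3), if_neg h.not_gt, sub_zero]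
  · simp [h]
  · obtain ⟨η, ⟨h1, h2⟩, h3⟩ :=
      (((hc.eventually_rightLim 0).and hS).and (mem_nhdsWithin_of_mem_nhds (gt_mem_nhds h))).exists
    rw [← h1, hf.alpha_eq_left hc k h2 h3, if_pos h]
    ring

lemma alpha_leftLim_zero (hf : IsRiemannSolution eos a WL WR f) (k : Fin 2) :
    f.u2 * alpha (proj (Function.leftLim f.W 0)) k = f.u2 * alpha (proj WL) k
      + if f.u2 < 0 then f.u2 * (alpha (proj WR) k - alpha (proj WL) k) else 0 := by
  obtain ⟨S, hc, -⟩ := hf.exists_constOff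
  have hS : ∀ᶠ η in 𝓝[<] (0 : ℝ), η ∉ S := by
    obtain ⟨u, hu, hs⟩ := exists_lt_forall_notMem_Ioo S 0
    filter_upwards [Ioo_mem_nhdsLT hu] with η hη hη' using hs η hη' hη
  rcases lt_trichotomy f.u2 0 with h | h | h
  · obtain ⟨η, ⟨h1, h2⟩, h3⟩ :=
      (((hc.eventually_leftLim 0).and hS).and (mem_nhdsWithin_of_mem_nhds (lt_mem_nhds h))).exists
    rw [← h1, hf.alpha_eq_right hc k h2 h3, if_pos h]
    ring
  · simp [h]
  · obtain ⟨η, ⟨h1, h2⟩, h3⟩ :=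
      (((hc.eventually_leftLim 0).and hS).and self_mem_nhdsWithin).exists
    rw [← h1, hf.alpha_eq_left hc k h2 (lt_trans h3 h), if_neg h.not_gt, add_zero]

/-- The relative mass flux `m (u - ξ)` decreases through the fan. -/
lemma relative_mass_flux_antitone (hf : IsRiemannSolution eos a WL WR f) {S : Finset ℝ}
    (hc : ConstOff S f.W) (hΩ : ∀ ξ ∉ S, f.W ξ ∈ OmegaW) (k : Fin 2) {ξ η : ℝ} (hξ : ξ ∉ S)
    (hη : η ∉ S) (hle : ξ ≤ η) :
    mass (proj (f.W η)) k * (vel (proj (f.W η)) k - η)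
      ≤ mass (proj (f.W ξ)) k * (vel (proj (f.W ξ)) k - ξ) := by
  rcases hle.eq_or_lt with rfl | hlt
  · exact le_rfl
  have h1 := (hc.eventually_eq hξ).filter_mono (nhdsWithin_le_nhds (s := Ioi ξ))
  have h2 := (hc.eventually_eq hη).filter_mono (nhdsWithin_le_nhds (s := Iio η))
  -- The integrated mass balance says that the drop of the relative flux from `ξ` to `η` is the
  -- integral of the positive mass.
  have h3 := (hf.mass_eq k).integral_eq (hc.comp fun W => mass (proj W) k)
    (hc.comp fun W => mass (proj W) k * vel (proj W) k) hlt
    (h1.mono fun _ h => congrArg (fun W => mass (proj W) k) h)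
    (h1.mono fun _ h => congrArg (fun W => mass (proj W) k * vel (proj W) k) h)
    (h2.mono fun _ h => congrArg (fun W => mass (proj W) k) h)
    (h2.mono fun _ h => congrArg (fun W => mass (proj W) k * vel (proj W) k) h)
  have h4 := (hc.comp fun W => mass (proj W) k).integral_pos
    (fun ζ hζ => mass_pos_of_mem (hΩ ζ hζ) k) hlt
  simp only [ite_self] at h3
  linarith

/-- The relative mass flux `M = m(u - ξ)` is continuous across `ξ`, and so is `M s`. Where `M ≠ 0`
the specific entropy therefore cannot jump. -/
lemma spEnt_jump (hf : IsRiemannSolution eos a WL WR f) {S : Finset ℝ} (hc : ConstOff S f.W)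
    (k : Fin 2) {ξ : ℝ}
    (hξ : mass (proj (Function.leftLim f.W ξ)) k * (vel (proj (Function.leftLim f.W ξ)) k - ξ) ≠ 0) :
    ∃ v, (∀ᶠ η in 𝓝[<] ξ, spEnt (proj (f.W η)) k = v) ∧
      ∀ᶠ η in 𝓝[>] ξ, spEnt (proj (f.W η)) k = v := by
  have hl := hc.eventually_leftLim ξ
  have hr := hc.eventually_rightLim ξ
  have cl := fun Φ : RelaxState → ℝ => hl.mono fun _ h => congrArg Φ h
  have cr := fun Φ : RelaxState → ℝ => hr.mono fun _ h => congrArg Φ h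
  have h1 := (hf.mass_eq k).rankine_hugoniot (cl fun W => mass (proj W) k)
    (cr fun W => mass (proj W) k) (cl fun W => mass (proj W) k * vel (proj W) k)
    (cr fun W => mass (proj W) k * vel (proj W) k)
  have h2 := (hf.entropy_eq k).rankine_hugoniot (cl fun W => mass (proj W) k * spEnt (proj W) k)
    (cr fun W => mass (proj W) k * spEnt (proj W) k)
    (cl fun W => mass (proj W) k * spEnt (proj W) k * vel (proj W) k)
    (cr fun W => mass (proj W) k * spEnt (proj W) k * vel (proj W) k)
  simp only [ite_self] at h1 h2
  refine ⟨_, cl fun W => spEnt (proj W) k, ?_⟩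
  have : spEnt (proj (Function.rightLim f.W ξ)) k = spEnt (proj (Function.leftLim f.W ξ)) k := by
    refine mul_left_cancel₀ hξ ?_
    linear_combination h2 - spEnt (proj (Function.rightLim f.W ξ)) k * h1
  exact this ▸ cr fun W => spEnt (proj W) k

/-- Since `M` decreases with `ξ`, it is positive everywhere to the left of a point where it is
positive. No entropy jump separates this point from the left state. -/
lemma spEnt_eq_left (hf : IsRiemannSolution eos a WL WR f) {S : Finset ℝ} (hc : ConstOff S f.W)
    (hΩ : ∀ ξ ∉ S, f.W ξ ∈ OmegaW) (k : Fin 2) {ξ : ℝ} (hξ : ξ ∉ S)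
    (hw : 0 < mass (proj (f.W ξ)) k * (vel (proj (f.W ξ)) k - ξ)) :
    spEnt (proj (f.W ξ)) k = spEnt (proj WL) k := by
  obtain ⟨ζ, hζ, hζS, he⟩ := hf.exists_left_state S ξ
  have := (hc.comp fun W => spEnt (proj W) k).eq_of_forall_jump_eq hζ.le hζS hξ
    fun η hη => hf.spEnt_jump hc k (ne_of_gt (hw.trans_le ?_))
  · simp only [he] at this
    exact this.symm
  -- The trace of `M` at a possible jump `η` is the limit of its values at `θ < η`, each of which is
  -- at least the value at `ξ`.
  · refine ge_of_tendsto (f := fun θ => mass (proj (Function.leftLim f.W η)) k *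
      (vel (proj (Function.leftLim f.W η)) k - θ)) (x := 𝓝[<] η)
      ((Continuous.tendsto (by fun_prop) η).mono_left nhdsWithin_le_nhds) ?_
    obtain ⟨l, hl, hs⟩ := exists_lt_forall_notMem_Ioo S η
    filter_upwards [hc.eventually_leftLim η, Ioo_mem_nhdsLT hl] with θ h1 h2
    rw [← h1]
    exact hf.relative_mass_flux_antitone hc hΩ k (fun hm => hs θ hm h2) hξ (h2.2.trans hη.2).le

lemma spEnt_eq_right (hf : IsRiemannSolution eos a WL WR f) {S : Finset ℝ} (hc : ConstOff S f.W)
    (hΩ : ∀ ξ ∉ S, f.W ξ ∈ OmegaW) (k : Fin 2) {ξ : ℝ} (hξ : ξ ∉ S)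
    (hw : mass (proj (f.W ξ)) k * (vel (proj (f.W ξ)) k - ξ) < 0) :
    spEnt (proj (f.W ξ)) k = spEnt (proj WR) k := by
  obtain ⟨ζ, hζ, hζS, he⟩ := hf.exists_right_state S ξ
  have := (hc.comp fun W => spEnt (proj W) k).eq_of_forall_jump_eq hζ.le hξ hζS
    fun η hη => hf.spEnt_jump hc k (ne_of_lt (lt_of_le_of_lt ?_ hw))
  · simp only [he] at this
    exact this
  · refine le_of_tendsto (f := fun θ => mass (proj (Function.leftLim f.W η)) k *
      (vel (proj (Function.leftLim f.W η)) k - θ)) (x := 𝓝[<] η)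
      ((Continuous.tendsto (by fun_prop) η).mono_left nhdsWithin_le_nhds) ?_
    obtain ⟨l, hl, hs⟩ := exists_lt_forall_notMem_Ioo S η
    filter_upwards [hc.eventually_leftLim η, Ioo_mem_nhdsLT hl,
      mem_nhdsWithin_of_mem_nhds (lt_mem_nhds hη.1)] with θ h1 h2 h3
    rw [← h1]
    exact hf.relative_mass_flux_antitone hc hΩ k hξ (fun hm => hs θ hm h2) h3.le

/-- The specific entropies take only the values of the initial states. -/
theorem spEnt_eq_or (hf : IsRiemannSolution eos a WL WR f) {S : Finset ℝ} (hc : ConstOff S f.W)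
    (hΩ : ∀ ξ ∉ S, f.W ξ ∈ OmegaW) (k : Fin 2) {ξ : ℝ} (hξ : ξ ∉ S) :
    spEnt (proj (f.W ξ)) k = spEnt (proj WL) k ∨ spEnt (proj (f.W ξ)) k = spEnt (proj WR) k := by
  rcases lt_trichotomy (mass (proj (f.W ξ)) k * (vel (proj (f.W ξ)) k - ξ)) 0 with h | h | h
  · exact Or.inr (hf.spEnt_eq_right hc hΩ k hξ h)
  -- If `M = 0` at a point of constancy, a small shift to the left makes `M` positive without
  -- changing the state.
  · left
    have hm := mass_pos_of_mem (hΩ ξ hξ) k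
    obtain ⟨l, hl, hs⟩ := exists_lt_forall_notMem_Ioo S ξ
    obtain ⟨η, ⟨h1, h2⟩⟩ := (((hc.eventually_eq hξ).filter_mono
      (nhdsWithin_le_nhds (s := Iio ξ))).and (Ioo_mem_nhdsLT hl)).exists
    rw [← h1]
    refine hf.spEnt_eq_left hc hΩ k (fun hm => hs η hm h2) ?_
    rw [h1]
    have h3 := mul_pos hm (sub_pos.2 h2.2)
    linarith
  · exact Or.inl (hf.spEnt_eq_left hc hΩ k hξ h)

end IsRiemannSolution

variable {eos : Fin 2 → PhaseEOS}

/-! ### Components of the numerical fluxes -/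

section flux

variable (Wr : RiemannSolver) (a : Fin 2 → ℝ) (UL UR : AuxState) (k : Fin 2)

lemma fluxMinus_zero : fluxMinus eos Wr a UL UR 0 =
    if (interfaceFan Wr a UL UR).u2 < 0 then
      (interfaceFan Wr a UL UR).u2 * (alpha UR 0 - alpha UL 0) else 0 := by
  simp only [fluxMinus, Pi.add_apply]
  split_ifs <;> simp [proj, relFlux, Dstar, lift, alpha, mul_comm]

lemma fluxPlus_zero : fluxPlus eos Wr a UL UR 0 =
    -if 0 < (interfaceFan Wr a UL UR).u2 then
      (interfaceFan Wr a UL UR).u2 * (alpha UR 0 - alpha UL 0) else 0 := by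
  simp only [fluxPlus, Pi.sub_apply]
  split_ifs <;> simp [proj, relFlux, Dstar, lift, alpha, mul_comm]

lemma fluxMinus_mass : fluxMinus eos Wr a UL UR (massIdx k) =
    mass (proj (Function.leftLim (interfaceFan Wr a UL UR).W 0)) k
      * vel (proj (Function.leftLim (interfaceFan Wr a UL UR).W 0)) k := by
  simp only [fluxMinus, Pi.add_apply]
  split_ifs <;> fin_cases k <;> simp [proj, relFlux, Dstar, massIdx]

lemma fluxPlus_mass : fluxPlus eos Wr a UL UR (massIdx k) =
    mass (proj (Function.rightLim (interfaceFan Wr a UL UR).W 0)) k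
      * vel (proj (Function.rightLim (interfaceFan Wr a UL UR).W 0)) k := by
  simp only [fluxPlus, Pi.sub_apply]
  split_ifs <;> fin_cases k <;> simp [proj, relFlux, Dstar, massIdx]

lemma fluxMinus_ent : fluxMinus eos Wr a UL UR (entIdx k) =
    ent (proj (Function.leftLim (interfaceFan Wr a UL UR).W 0)) k
      * vel (proj (Function.leftLim (interfaceFan Wr a UL UR).W 0)) k := by
  simp only [fluxMinus, Pi.add_apply]
  split_ifs <;> fin_cases k <;> simp [proj, relFlux, Dstar, entIdx]

lemma fluxPlus_ent : fluxPlus eos Wr a UL UR (entIdx k) =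
    ent (proj (Function.rightLim (interfaceFan Wr a UL UR).W 0)) k
      * vel (proj (Function.rightLim (interfaceFan Wr a UL UR).W 0)) k := by
  simp only [fluxPlus, Pi.sub_apply]
  split_ifs <;> fin_cases k <;> simp [proj, relFlux, Dstar, entIdx]

lemma fluxMinus_mom : fluxMinus eos Wr a UL UR (momIdx k) =
    momFlux eos a (Function.leftLim (interfaceFan Wr a UL UR).W 0) k
      - if (interfaceFan Wr a UL UR).u2 < 0 then
          (interfaceFan Wr a UL UR).pi1 * (alpha UR k - alpha UL k) else 0 := by
  simp only [fluxMinus, Pi.add_apply]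
  split_ifs <;> fin_cases k <;> simp [proj, relFlux, Dstar, lift, alpha, momIdx] <;> ring

lemma fluxPlus_mom : fluxPlus eos Wr a UL UR (momIdx k) =
    momFlux eos a (Function.rightLim (interfaceFan Wr a UL UR).W 0) k
      + if 0 < (interfaceFan Wr a UL UR).u2 then
          (interfaceFan Wr a UL UR).pi1 * (alpha UR k - alpha UL k) else 0 := by
  simp only [fluxPlus, Pi.sub_apply]
  split_ifs <;> fin_cases k <;> simp [proj, relFlux, Dstar, lift, alpha, momIdx] <;> ring

end flux

/-! ### Flux consistency and half-fan integrals at one interface. -/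

namespace SolvesInterface

variable {Wr : RiemannSolver} {a : Fin 2 → ℝ} {UL UR : AuxState}

lemma fluxMinus_mass_eq (h : SolvesInterface eos Wr a UL UR) (k : Fin 2) :
    fluxMinus eos Wr a UL UR (massIdx k) = fluxPlus eos Wr a UL UR (massIdx k) := by
  have := IsRiemannSolution.jump_zero h (Φ := fun W => mass (proj W) k)
    (Ψ := fun W => mass (proj W) k * vel (proj W) k) (h.mass_eq k)
  rw [ite_self] at this
  rw [fluxMinus_mass, fluxPlus_mass]
  linarith

lemma fluxMinus_ent_eq (h : SolvesInterface eos Wr a UL UR) (k : Fin 2) :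
    fluxMinus eos Wr a UL UR (entIdx k) = fluxPlus eos Wr a UL UR (entIdx k) := by
  have := IsRiemannSolution.jump_zero h (Φ := fun W => mass (proj W) k * spEnt (proj W) k)
    (Ψ := fun W => mass (proj W) k * spEnt (proj W) k * vel (proj W) k) (h.entropy_eq k)
  rw [ite_self, mass_mul_spEnt (mass_pos_of_mem (h.leftLim_mem 0) k),
    mass_mul_spEnt (mass_pos_of_mem (h.rightLim_mem 0) k)] at this
  rw [fluxMinus_ent, fluxPlus_ent]
  linarith

/-- The jumps of `α₁` and `α₂` are opposite, so the `π₁*` sources cancel in the sum. This includes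
`u₂* = 0`, where the source sits at `ξ = 0` and neither flux contains `Dstar`. -/
lemma sum_fluxMinus_mom_eq (h : SolvesInterface eos Wr a UL UR) :
    ∑ k, fluxMinus eos Wr a UL UR (momIdx k) = ∑ k, fluxPlus eos Wr a UL UR (momIdx k) := by
  have hj := fun k => IsRiemannSolution.jump_zero h
    (Φ := fun W => mass (proj W) k * vel (proj W) k) (Ψ := fun W => momFlux eos a W k)
    (h.momentum_eq k)
  have h0 := hj 0
  have h1 := hj 1
  simp only [proj_lift] at h0 h1
  have hR := sum_alpha UR
  have hL := sum_alpha UL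
  have hΔ : alpha UR 1 - alpha UL 1 = -(alpha UR 0 - alpha UL 0) := by linarith
  rw [hΔ] at h1
  simp only [Fin.sum_univ_two, fluxMinus_mom, fluxPlus_mom, hΔ]
  split_ifs at h0 h1 ⊢ <;> linarith

section half

variable {x : ℝ} (h : SolvesInterface eos Wr a UL UR) (hx : 0 < x) (k : Fin 2)
include h hx

lemma integral_alpha_right (hR : ∀ k, vel UR k + a k * vol UR k < x) :
    ∫ ξ in (0 : ℝ)..x, alpha (proj ((interfaceFan Wr a UL UR).W ξ)) k
      = x * alpha UR k - if 0 < (interfaceFan Wr a UL UR).u2 then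
          (interfaceFan Wr a UL UR).u2 * (alpha UR k - alpha UL k) else 0 := by
  have h1 := IsRiemannSolution.integral_right h (Φ := fun W => alpha (proj W) k)
    (Ψ := fun W => (interfaceFan Wr a UL UR).u2 * alpha (proj W) k) (h.fraction_eq k) hx hR
  have h2 := IsRiemannSolution.alpha_rightLim_zero h k
  simp only [proj_lift, ite_self] at h1 h2
  linarith

lemma integral_alpha_left (hL : ∀ k, -x < vel UL k - a k * vol UL k) :
    ∫ ξ in (-x)..0, alpha (proj ((interfaceFan Wr a UL UR).W ξ)) k
      = x * alpha UL k - if (interfaceFan Wr a UL UR).u2 < 0 then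
          (interfaceFan Wr a UL UR).u2 * (alpha UR k - alpha UL k) else 0 := by
  have h1 := IsRiemannSolution.integral_left h (Φ := fun W => alpha (proj W) k)
    (Ψ := fun W => (interfaceFan Wr a UL UR).u2 * alpha (proj W) k) (h.fraction_eq k) hx hL
  have h2 := IsRiemannSolution.alpha_leftLim_zero h k
  simp only [proj_lift, ite_self] at h1 h2
  linarith

lemma integral_mass_right (hR : ∀ k, vel UR k + a k * vol UR k < x) :
    ∫ ξ in (0 : ℝ)..x, mass (proj ((interfaceFan Wr a UL UR).W ξ)) k
      = x * mass UR k - mass UR k * vel UR k + fluxPlus eos Wr a UL UR (massIdx k) := by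
  have h1 := IsRiemannSolution.integral_right h (Φ := fun W => mass (proj W) k)
    (Ψ := fun W => mass (proj W) k * vel (proj W) k) (h.mass_eq k) hx hR
  simp only [proj_lift, ite_self] at h1
  rw [fluxPlus_mass]
  linarith

lemma integral_mass_left (hL : ∀ k, -x < vel UL k - a k * vol UL k) :
    ∫ ξ in (-x)..0, mass (proj ((interfaceFan Wr a UL UR).W ξ)) k
      = x * mass UL k + mass UL k * vel UL k - fluxMinus eos Wr a UL UR (massIdx k) := by
  have h1 := IsRiemannSolution.integral_left h (Φ := fun W => mass (proj W) k)
    (Ψ := fun W => mass (proj W) k * vel (proj W) k) (h.mass_eq k) hx hL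
  simp only [proj_lift, ite_self] at h1
  rw [fluxMinus_mass]
  linarith

omit hx in
lemma ae_mem : ∀ᵐ ξ, (interfaceFan Wr a UL UR).W ξ ∈ OmegaW := by
  obtain ⟨S, -, hΩ⟩ := IsRiemannSolution.exists_constOff h
  exact (ae_notMem_finset S).mono hΩ

lemma integral_ent_right (hR : ∀ k, vel UR k + a k * vol UR k < x) (hm : 0 < mass UR k) :
    ∫ ξ in (0 : ℝ)..x, ent (proj ((interfaceFan Wr a UL UR).W ξ)) k
      = x * ent UR k - ent UR k * vel UR k + fluxPlus eos Wr a UL UR (entIdx k) := by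
  have h1 := IsRiemannSolution.integral_right h (Φ := fun W => mass (proj W) k * spEnt (proj W) k)
    (Ψ := fun W => mass (proj W) k * spEnt (proj W) k * vel (proj W) k) (h.entropy_eq k) hx hR
  simp only [proj_lift, ite_self] at h1
  rw [mass_mul_spEnt (mass_pos_of_mem (h.rightLim_mem 0) k), mass_mul_spEnt hm,
    intervalIntegral.integral_congr_ae (h.ae_mem.mono fun _ hW _ =>
      mass_mul_spEnt (mass_pos_of_mem hW k))] at h1
  rw [fluxPlus_ent]
  linarith

lemma integral_ent_left (hL : ∀ k, -x < vel UL k - a k * vol UL k) (hm : 0 < mass UL k) :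
    ∫ ξ in (-x)..0, ent (proj ((interfaceFan Wr a UL UR).W ξ)) k
      = x * ent UL k + ent UL k * vel UL k - fluxMinus eos Wr a UL UR (entIdx k) := by
  have h1 := IsRiemannSolution.integral_left h (Φ := fun W => mass (proj W) k * spEnt (proj W) k)
    (Ψ := fun W => mass (proj W) k * spEnt (proj W) k * vel (proj W) k) (h.entropy_eq k) hx hL
  simp only [proj_lift, ite_self] at h1
  rw [mass_mul_spEnt (mass_pos_of_mem (h.leftLim_mem 0) k), mass_mul_spEnt hm,
    intervalIntegral.integral_congr_ae (h.ae_mem.mono fun _ hW _ =>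
      mass_mul_spEnt (mass_pos_of_mem hW k))] at h1
  rw [fluxMinus_ent]
  linarith

lemma integral_mom_right (hR : ∀ k, vel UR k + a k * vol UR k < x) (hm : 0 < mass UR k) :
    ∫ ξ in (0 : ℝ)..x, mom (proj ((interfaceFan Wr a UL UR).W ξ)) k
      = x * mom UR k - momFlux eos a (lift UR) k + fluxPlus eos Wr a UL UR (momIdx k) := by
  have h1 := IsRiemannSolution.integral_right h (Φ := fun W => mass (proj W) k * vel (proj W) k)
    (Ψ := fun W => momFlux eos a W k) (h.momentum_eq k) hx hR
  simp only [proj_lift] at h1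
  rw [mass_mul_vel hm, intervalIntegral.integral_congr_ae (h.ae_mem.mono fun _ hW _ =>
      mass_mul_vel (mass_pos_of_mem hW k))] at h1
  rw [fluxPlus_mom]
  linarith

lemma integral_mom_left (hL : ∀ k, -x < vel UL k - a k * vol UL k) (hm : 0 < mass UL k) :
    ∫ ξ in (-x)..0, mom (proj ((interfaceFan Wr a UL UR).W ξ)) k
      = x * mom UL k + momFlux eos a (lift UL) k - fluxMinus eos Wr a UL UR (momIdx k) := by
  have h1 := IsRiemannSolution.integral_left h (Φ := fun W => mass (proj W) k * vel (proj W) k)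
    (Ψ := fun W => momFlux eos a W k) (h.momentum_eq k) hx hL
  simp only [proj_lift] at h1
  rw [mass_mul_vel hm, intervalIntegral.integral_congr_ae (h.ae_mem.mono fun _ hW _ =>
      mass_mul_vel (mass_pos_of_mem hW k))] at h1
  rw [fluxMinus_mom]
  linarith

omit hx in
-- Treats both phases at once: the source is at most the nonconservative product, with the deficit
-- `Q` for phase 1 and none for phase 2.
lemma exists_energy_balance : ∃ c, c ≤ (interfaceFan Wr a UL UR).u2 * (interfaceFan Wr a UL UR).pi1
      * (alpha UR k - alpha UL k) ∧
    SelfSimilarBalance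
      (fun ξ => mass (proj ((interfaceFan Wr a UL UR).W ξ)) k
        * relEnergy eos a ((interfaceFan Wr a UL UR).W ξ) k)
      (fun ξ => energyFlux eos a ((interfaceFan Wr a UL UR).W ξ) k) c
      (interfaceFan Wr a UL UR).u2 := by
  fin_cases k
  · obtain ⟨Q, hQ, hb⟩ := h.energy_eq_one
    simp only [proj_lift] at hb
    exact ⟨_, sub_le_self _ hQ, hb⟩
  · have hb := h.energy_eq_two
    simp only [proj_lift] at hb
    exact ⟨_, le_rfl, hb⟩

lemma integral_energy_right (hR : ∀ k, vel UR k + a k * vol UR k < x) :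
    ∫ ξ in (0 : ℝ)..x, mass (proj ((interfaceFan Wr a UL UR).W ξ)) k
        * relEnergy eos a ((interfaceFan Wr a UL UR).W ξ) k
      ≤ x * totEnergy eos UR k - energyFlux eos a (lift UR) k
        + interfaceEnergyFlux eos Wr a UL UR k
        + if 0 ≤ (interfaceFan Wr a UL UR).u2 then (interfaceFan Wr a UL UR).u2
            * (interfaceFan Wr a UL UR).pi1 * (alpha UR k - alpha UL k) else 0 := by
  obtain ⟨c, hc, hb⟩ := h.exists_energy_balance k
  have h1 := IsRiemannSolution.integral_right h
    (Φ := fun W => mass (proj W) k * relEnergy eos a W k)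
    (Ψ := fun W => energyFlux eos a W k) hb hx hR
  rw [h1, mass_mul_relEnergy_lift, interfaceEnergyFlux]
  rcases lt_trichotomy (interfaceFan Wr a UL UR).u2 0 with hu | hu | hu
  · rw [if_neg hu.not_gt, if_neg hu.not_ge]
  · simp [hu]
  · rw [if_pos hu, if_pos hu.le]
    linarith

lemma integral_energy_left (hL : ∀ k, -x < vel UL k - a k * vol UL k) :
    ∫ ξ in (-x)..0, mass (proj ((interfaceFan Wr a UL UR).W ξ)) k
        * relEnergy eos a ((interfaceFan Wr a UL UR).W ξ) k
      ≤ x * totEnergy eos UL k + energyFlux eos a (lift UL) k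
        - interfaceEnergyFlux eos Wr a UL UR k
        + if (interfaceFan Wr a UL UR).u2 ≤ 0 then (interfaceFan Wr a UL UR).u2
            * (interfaceFan Wr a UL UR).pi1 * (alpha UR k - alpha UL k) else 0 := by
  obtain ⟨c, hc, hb⟩ := h.exists_energy_balance k
  have h1 := IsRiemannSolution.integral_left h
    (Φ := fun W => mass (proj W) k * relEnergy eos a W k)
    (Ψ := fun W => energyFlux eos a W k) hb hx hL
  -- The interface flux is a right trace, while this half of the fan ends with the left trace. They
  -- differ only when `u₂* = 0`; the jump is then `c ≤ 0`, which has the favourable sign.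
  have h2 := IsRiemannSolution.jump_zero h
    (Φ := fun W => mass (proj W) k * relEnergy eos a W k)
    (Ψ := fun W => energyFlux eos a W k) hb
  rw [h1, mass_mul_relEnergy_lift, interfaceEnergyFlux]
  rcases lt_trichotomy (interfaceFan Wr a UL UR).u2 0 with hu | hu | hu
  · rw [if_neg hu.ne] at h2
    rw [if_pos hu, if_pos hu.le]
    linarith
  · rw [if_pos hu] at h2
    simp only [hu, zero_mul, lt_irrefl, le_refl, if_true, if_false] at hc ⊢
    linarith
  · rw [if_neg hu.ne'] at h2
    rw [if_neg hu.not_gt, if_neg hu.not_ge]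
    linarith

end half

end SolvesInterface

/-! ### Cell averages -/

/-- `V` is the average over a cell of the right half of the fan `W₁` and the left half of the fan
`W₂`. -/
structure IsCellAverage (W₁ W₂ : ℝ → RelaxState) (x : ℝ) (V : AuxState) : Prop where
  alpha_eq : ∀ k, 2 * x * alpha V k = (∫ ξ in (0 : ℝ)..x, alpha (proj (W₁ ξ)) k)
    + ∫ ξ in (-x)..0, alpha (proj (W₂ ξ)) k
  mass_eq : ∀ k, 2 * x * mass V k = (∫ ξ in (0 : ℝ)..x, mass (proj (W₁ ξ)) k)
    + ∫ ξ in (-x)..0, mass (proj (W₂ ξ)) k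
  mom_eq : ∀ k, 2 * x * mom V k = (∫ ξ in (0 : ℝ)..x, mom (proj (W₁ ξ)) k)
    + ∫ ξ in (-x)..0, mom (proj (W₂ ξ)) k
  ent_eq : ∀ k, 2 * x * ent V k = (∫ ξ in (0 : ℝ)..x, ent (proj (W₁ ξ)) k)
    + ∫ ξ in (-x)..0, ent (proj (W₂ ξ)) k

lemma ConstOff.integral_linear {S : Finset ℝ} {W : ℝ → RelaxState} (h : ConstOff S W)
    (k : Fin 2) (c₀ c₁ c₂ c₃ s t : ℝ) :
    ∫ ξ in s..t, (c₀ * alpha (proj (W ξ)) k + c₁ * mass (proj (W ξ)) k + c₂ * mom (proj (W ξ)) k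
        + c₃ * ent (proj (W ξ)) k)
      = c₀ * (∫ ξ in s..t, alpha (proj (W ξ)) k) + c₁ * (∫ ξ in s..t, mass (proj (W ξ)) k)
        + c₂ * (∫ ξ in s..t, mom (proj (W ξ)) k) + c₃ * ∫ ξ in s..t, ent (proj (W ξ)) k := by
  have hi : ∀ (Φ : RelaxState → ℝ) (c : ℝ),
      IntervalIntegrable (fun ξ => c * Φ (W ξ)) volume s t :=
    fun Φ c => ((h.comp Φ).intervalIntegrable s t).const_mul c
  have i0 := hi (fun W => alpha (proj W) k) c₀
  have i1 := hi (fun W => mass (proj W) k) c₁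
  have i2 := hi (fun W => mom (proj W) k) c₂
  have i3 := hi (fun W => ent (proj W) k) c₃
  rw [intervalIntegral.integral_add ((i0.add i1).add i2) i3,
    intervalIntegral.integral_add (i0.add i1) i2, intervalIntegral.integral_add i0 i1]
  simp only [intervalIntegral.integral_const_mul]

namespace IsCellAverage

variable {S₁ S₂ : Finset ℝ} {W₁ W₂ : ℝ → RelaxState} {x : ℝ} {V : AuxState}

/-- Jensen's inequality for a lower bound that is affine in the state. -/
lemma le_of_forall_le (hV : IsCellAverage W₁ W₂ x V) (h₁ : ConstOff S₁ W₁) (h₂ : ConstOff S₂ W₂)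
    (hx : 0 < x) (k : Fin 2) (c₀ c₁ c₂ c₃ : ℝ) (Φ₁ Φ₂ : RelaxState → ℝ)
    (hΦ₁ : ∀ᵐ ξ, c₀ * alpha (proj (W₁ ξ)) k + c₁ * mass (proj (W₁ ξ)) k
      + c₂ * mom (proj (W₁ ξ)) k + c₃ * ent (proj (W₁ ξ)) k ≤ Φ₁ (W₁ ξ))
    (hΦ₂ : ∀ᵐ ξ, c₀ * alpha (proj (W₂ ξ)) k + c₁ * mass (proj (W₂ ξ)) k
      + c₂ * mom (proj (W₂ ξ)) k + c₃ * ent (proj (W₂ ξ)) k ≤ Φ₂ (W₂ ξ)) :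
    2 * x * (c₀ * alpha V k + c₁ * mass V k + c₂ * mom V k + c₃ * ent V k)
      ≤ (∫ ξ in (0 : ℝ)..x, Φ₁ (W₁ ξ)) + ∫ ξ in (-x)..0, Φ₂ (W₂ ξ) := by
  have m₁ := (h₁.comp fun W => c₀ * alpha (proj W) k + c₁ * mass (proj W) k
    + c₂ * mom (proj W) k + c₃ * ent (proj W) k).integral_mono (h₁.comp Φ₁) hΦ₁ hx.le
  have m₂ := (h₂.comp fun W => c₀ * alpha (proj W) k + c₁ * mass (proj W) k
    + c₂ * mom (proj W) k + c₃ * ent (proj W) k).integral_mono (h₂.comp Φ₂) hΦ₂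
    (by linarith : -x ≤ 0)
  rw [h₁.integral_linear] at m₁
  rw [h₂.integral_linear] at m₂
  have e0 := hV.alpha_eq k
  have e1 := hV.mass_eq k
  have e2 := hV.mom_eq k
  have e3 := hV.ent_eq k
  linear_combination m₁ + m₂ + c₀ * e0 + c₁ * e1 + c₂ * e2 + c₃ * e3

variable (hV : IsCellAverage W₁ W₂ x V) (h₁ : ConstOff S₁ W₁) (h₂ : ConstOff S₂ W₂)
  (hx : 0 < x) (hΩ₁ : ∀ ξ ∉ S₁, W₁ ξ ∈ OmegaW) (hΩ₂ : ∀ ξ ∉ S₂, W₂ ξ ∈ OmegaW) (k : Fin 2)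
include hV h₁ h₂ hx hΩ₁ hΩ₂

lemma alpha_pos : 0 < alpha V k := by
  have i1 := (h₁.comp fun W => alpha (proj W) k).integral_pos
    (fun ξ hξ => alpha_pos_of_mem (hΩ₁ ξ hξ) k) hx
  have i2 := (h₂.comp fun W => alpha (proj W) k).integral_pos
    (fun ξ hξ => alpha_pos_of_mem (hΩ₂ ξ hξ) k) (by linarith : -x < 0)
  have := hV.alpha_eq k
  exact pos_of_mul_pos_right (by linarith : 0 < 2 * x * alpha V k) (by linarith)

lemma mass_pos : 0 < mass V k := by
  have i1 := (h₁.comp fun W => mass (proj W) k).integral_pos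
    (fun ξ hξ => mass_pos_of_mem (hΩ₁ ξ hξ) k) hx
  have i2 := (h₂.comp fun W => mass (proj W) k).integral_pos
    (fun ξ hξ => mass_pos_of_mem (hΩ₂ ξ hξ) k) (by linarith : -x < 0)
  have := hV.mass_eq k
  exact pos_of_mul_pos_right (by linarith : 0 < 2 * x * mass V k) (by linarith)

/-- The bound `m α_k ρ_k ≤ α_k ρ_k s_k` is linear in the state and so survives averaging: the new
specific entropy is a mass-weighted mean. -/
lemma le_spEnt {m : ℝ} (hm₁ : ∀ ξ ∉ S₁, m ≤ spEnt (proj (W₁ ξ)) k)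
    (hm₂ : ∀ ξ ∉ S₂, m ≤ spEnt (proj (W₂ ξ)) k) : m ≤ spEnt V k := by
  have hp := hV.mass_pos h₁ h₂ hx hΩ₁ hΩ₂ k
  have key : ∀ {W : RelaxState}, W ∈ OmegaW → m ≤ spEnt (proj W) k →
      0 * alpha (proj W) k + m * mass (proj W) k + 0 * mom (proj W) k + (-1) * ent (proj W) k ≤ 0 :=
    fun {W} hW hs => by
      have := mass_pos_of_mem hW k
      have e := mass_mul_spEnt this
      nlinarith
  have := hV.le_of_forall_le h₁ h₂ hx k 0 m 0 (-1) (fun _ => 0) (fun _ => 0)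
    ((ae_notMem_finset S₁).mono fun ξ hξ => key (hΩ₁ ξ hξ) (hm₁ ξ hξ))
    ((ae_notMem_finset S₂).mono fun ξ hξ => key (hΩ₂ ξ hξ) (hm₂ ξ hξ))
  simp only [intervalIntegral.integral_zero, add_zero] at this
  rw [spEnt, le_div_iff₀ hp]
  nlinarith

lemma spEnt_le {m : ℝ} (hm₁ : ∀ ξ ∉ S₁, spEnt (proj (W₁ ξ)) k ≤ m)
    (hm₂ : ∀ ξ ∉ S₂, spEnt (proj (W₂ ξ)) k ≤ m) : spEnt V k ≤ m := by
  have hp := hV.mass_pos h₁ h₂ hx hΩ₁ hΩ₂ k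
  have key : ∀ {W : RelaxState}, W ∈ OmegaW → spEnt (proj W) k ≤ m →
      0 * alpha (proj W) k + (-m) * mass (proj W) k + 0 * mom (proj W) k + 1 * ent (proj W) k ≤ 0 :=
    fun {W} hW hs => by
      have := mass_pos_of_mem hW k
      have e := mass_mul_spEnt this
      nlinarith
  have := hV.le_of_forall_le h₁ h₂ hx k 0 (-m) 0 1 (fun _ => 0) (fun _ => 0)
    ((ae_notMem_finset S₁).mono fun ξ hξ => key (hΩ₁ ξ hξ) (hm₁ ξ hξ))
    ((ae_notMem_finset S₂).mono fun ξ hξ => key (hΩ₂ ξ hξ) (hm₂ ξ hξ))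
  simp only [intervalIntegral.integral_zero, add_zero] at this
  rw [spEnt, div_le_iff₀ hp]
  nlinarith

end IsCellAverage

/-! ### Energy comparison and convexity of the total energy. -/

/-- Under Whitham's condition the relaxation energy dominates the total energy. -/
lemma totEnergy_le_relEnergy {a : Fin 2 → ℝ} {k : Fin 2} (ha : 0 < a k) {W : RelaxState}
    (hW : W ∈ OmegaW) (hs : spEnt (proj W) k ∈ (eos k).entropySet)
    (hc : ∀ θ ∈ uIcc (relVol W k) (vol (proj W) k),
      -deriv (fun τ => (eos k).pressure τ (spEnt (proj W) k)) θ < a k ^ 2) :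
    totEnergy eos (proj W) k ≤ mass (proj W) k * relEnergy eos a W k := by
  have h := PhaseEOS.energy_le_of_whitham (relVol_pos_of_mem hW k) (vol_pos_of_mem hW k) hs hc
  refine mul_le_mul_of_nonneg_left ?_ (mass_pos_of_mem hW k).le
  rw [relEnergy, relPressure, intEnergy]
  set P := (eos k).pressure (relVol W k) (spEnt (proj W) k)
  set d := relVol W k - vol (proj W) k
  -- The quadratic correction in the relaxation energy is exactly the remainder in the Taylor bound
  -- with `c = a_k²`.
  have : ((P + a k ^ 2 * d) ^ 2 - P ^ 2) / (2 * a k ^ 2) = P * d + a k ^ 2 * d ^ 2 / 2 := by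
    field_simp
    ring
  rw [this]
  linarith

/-- Supporting affine function of the convex function `U ↦ (α_k ρ_k E_k)(U)` at the state `V`. -/
lemma tangent_le_totEnergy {U V : AuxState} {k : Fin 2} (hm : 0 < mass U k) (hα : 0 < alpha U k)
    (hs : spEnt U k ∈ (eos k).entropySet) (hv : 0 < vol V k)
    (hs' : spEnt V k ∈ (eos k).entropySet) :
    -(eos k).pressure (vol V k) (spEnt V k) * alpha U k
      + (intEnergy eos V k - vel V k ^ 2 / 2 + (eos k).pressure (vol V k) (spEnt V k) * vol V k
          + (eos k).T (1 / vol V k) (intEnergy eos V k) * spEnt V k) * mass U k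
      + vel V k * mom U k + -(eos k).T (1 / vol V k) (intEnergy eos V k) * ent U k
      ≤ totEnergy eos U k := by
  have h := PhaseEOS.energy_tangent_le (τ' := vol U k) hv (div_pos hα hm) hs' hs
  rw [totEnergy, ← mass_mul_vel hm, ← mass_mul_spEnt hm, ← mass_mul_vol hm]
  change _ ≤ intEnergy eos U k at h
  rw [← intEnergy] at h
  generalize (eos k).pressure (vol V k) (spEnt V k) = P at *
  generalize (eos k).T (1 / vol V k) (intEnergy eos V k) = T at *
  -- The gap splits into the thermodynamic tangent inequality times the mass and the kinetic term `m
  -- (u_U - u_V)² / 2`.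
  have h1 := mul_le_mul_of_nonneg_left h hm.le
  have h2 := mul_nonneg hm.le (sq_nonneg (vel U k - vel V k))
  linear_combination h1 + h2 / 2

/-- The affine function touches the energy at `V`. The terms in `P` and in `T` cancel separately
there, so both may be arbitrary. -/
lemma tangent_eq_totEnergy {V : AuxState} {k : Fin 2} (hm : 0 < mass V k) (P T : ℝ) :
    -P * alpha V k
      + (intEnergy eos V k - vel V k ^ 2 / 2 + P * vol V k + T * spEnt V k) * mass V k
      + vel V k * mom V k + -T * ent V k = totEnergy eos V k := by
  rw [totEnergy, ← mass_mul_vel hm, ← mass_mul_spEnt hm, ← mass_mul_vol hm]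
  ring

lemma spEnt_mem_entropySet_of_mem {U : AuxState} (hU : U ∈ OmegaU eos) (k : Fin 2) :
    spEnt U k ∈ (eos k).entropySet :=
  PhaseEOS.mem_entropySet_of_energy_pos
    (pos_of_mul_pos_right (hU.2.2 k).2 (hU.2.2 k).1.le : 0 < intEnergy eos U k)

lemma vol_pos_of_mem_OmegaU {U : AuxState} (hU : U ∈ OmegaU eos) (k : Fin 2) : 0 < vol U k := by
  refine div_pos ?_ (hU.2.2 k).1
  fin_cases k
  · exact hU.1
  · exact sub_pos.2 hU.2.1

/-! ### One step of the scheme as a cell average. -/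

/-- A step of the scheme is a cell average of the fans at the two interfaces of the cell. -/
theorem isCellAverage_step {Wr : RiemannSolver} {a₁ a₂ : Fin 2 → ℝ} {UL UC UR V : AuxState}
    {Δt Δx : ℝ} (ht : 0 < Δt) (hx : 0 < Δx) (h₁ : SolvesInterface eos Wr a₁ UL UC)
    (h₂ : SolvesInterface eos Wr a₂ UC UR) (hm : ∀ k, 0 < mass UC k)
    (hR : ∀ k, vel UC k + a₁ k * vol UC k < Δx / (2 * Δt))
    (hL : ∀ k, -(Δx / (2 * Δt)) < vel UC k - a₂ k * vol UC k)
    (hV : V = UC - (Δt / Δx) • (fluxMinus eos Wr a₂ UC UR - fluxPlus eos Wr a₁ UL UC)) :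
    IsCellAverage (interfaceFan Wr a₁ UL UC).W (interfaceFan Wr a₂ UC UR).W (Δx / (2 * Δt)) V := by
  have hx' : 0 < Δx / (2 * Δt) := by positivity
  -- The update multiplied by `Δx/Δt`, which is the width `2x` of the cell in the variable `ξ`.
  have hc : ∀ i, 2 * (Δx / (2 * Δt)) * V i = 2 * (Δx / (2 * Δt)) * UC i
      - fluxMinus eos Wr a₂ UC UR i + fluxPlus eos Wr a₁ UL UC i := by
    intro i
    simp only [hV, Pi.sub_apply, Pi.smul_apply, smul_eq_mul]
    field_simp
    ring
  refine ⟨fun k => ?_, fun k => ?_, fun k => ?_, fun k => ?_⟩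
  · have h0 := hc 0
    rw [fluxMinus_zero, fluxPlus_zero] at h0
    rw [h₁.integral_alpha_right hx' k hR, h₂.integral_alpha_left hx' k hL]
    have h1 : ∀ U : AuxState, alpha U 1 = 1 - alpha U 0 := fun U => rfl
    change _ * alpha V 0 = _ * alpha UC 0 - _ + _ at h0
    fin_cases k
    · simp only [Fin.zero_eta]
      linarith
    · simp only [Fin.mk_one, h1]
      split_ifs at h0 ⊢ <;> linarith
  · rw [h₁.integral_mass_right hx' k hR, h₂.integral_mass_left hx' k hL]
    have h0 := hc (massIdx k)
    change _ * mass V k = _ * mass UC k - _ + _ at h0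
    linarith
  -- The two physical momentum fluxes of `UC` carry different relaxation parameters; they must be
  -- identified before they cancel.
  · rw [h₁.integral_mom_right hx' k hR (hm k), h₂.integral_mom_left hx' k hL (hm k),
      momFlux_lift a₁ a₂]
    have h0 := hc (momIdx k)
    change _ * mom V k = _ * mom UC k - _ + _ at h0
    linarith
  · rw [h₁.integral_ent_right hx' k hR (hm k), h₂.integral_ent_left hx' k hL (hm k)]
    have h0 := hc (entIdx k)
    change _ * ent V k = _ * ent UC k - _ + _ at h0
    linarith

variable {eos : Fin 2 → PhaseEOS} {Wr : RiemannSolver} {Δt Δx : ℝ}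

lemma CFL.right_lt {a : ℤ → Fin 2 → ℝ} {U : ℤ → AuxState} (h : CFL Δt Δx a U) (ht : 0 < Δt)
    (hx : 0 < Δx) (j : ℤ) (k : Fin 2) :
    vel (U (j + 1)) k + a j k * vol (U (j + 1)) k < Δx / (2 * Δt) := by
  have h1 := (h j k).2
  have h2 : |vel (U (j + 1)) k + a j k * vol (U (j + 1)) k| < Δx / (2 * Δt) := by
    rw [lt_div_iff₀ (by positivity)]
    field_simp at h1
    linarith
  exact (le_abs_self _).trans_lt h2

lemma CFL.lt_left {a : ℤ → Fin 2 → ℝ} {U : ℤ → AuxState} (h : CFL Δt Δx a U) (ht : 0 < Δt)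
    (hx : 0 < Δx) (j : ℤ) (k : Fin 2) :
    -(Δx / (2 * Δt)) < vel (U j) k - a j k * vol (U j) k := by
  have h1 := (h j k).1
  have h2 : |vel (U j) k - a j k * vol (U j) k| < Δx / (2 * Δt) := by
    rw [lt_div_iff₀ (by positivity)]
    field_simp at h1
    linarith
  exact neg_lt_of_abs_lt h2

section step

variable {a₁ a₂ : Fin 2 → ℝ} {UL UC UR V : AuxState} {x : ℝ}
  (h₁ : SolvesInterface eos Wr a₁ UL UC) (h₂ : SolvesInterface eos Wr a₂ UC UR)
  (hV : IsCellAverage (interfaceFan Wr a₁ UL UC).W (interfaceFan Wr a₂ UC UR).W x V) (hx : 0 < x)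
include h₁ h₂ hV hx

lemma step_alpha_pos (k : Fin 2) : 0 < alpha V k := by
  obtain ⟨S₁, hc₁, hΩ₁⟩ := IsRiemannSolution.exists_constOff h₁
  obtain ⟨S₂, hc₂, hΩ₂⟩ := IsRiemannSolution.exists_constOff h₂
  exact hV.alpha_pos hc₁ hc₂ hx hΩ₁ hΩ₂ k

lemma step_mass_pos (k : Fin 2) : 0 < mass V k := by
  obtain ⟨S₁, hc₁, hΩ₁⟩ := IsRiemannSolution.exists_constOff h₁
  obtain ⟨S₂, hc₂, hΩ₂⟩ := IsRiemannSolution.exists_constOff h₂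
  exact hV.mass_pos hc₁ hc₂ hx hΩ₁ hΩ₂ k

/-- A discrete maximum principle: each fan carries only entropies of its two data, and averaging
takes a mean of them. -/
lemma step_spEnt_le (k : Fin 2) :
    spEnt V k ≤ max (spEnt UL k) (max (spEnt UC k) (spEnt UR k)) := by
  obtain ⟨S₁, hc₁, hΩ₁⟩ := IsRiemannSolution.exists_constOff h₁
  obtain ⟨S₂, hc₂, hΩ₂⟩ := IsRiemannSolution.exists_constOff h₂
  refine hV.spEnt_le hc₁ hc₂ hx hΩ₁ hΩ₂ k (fun ξ hξ => ?_) fun ξ hξ => ?_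
  · rcases IsRiemannSolution.spEnt_eq_or h₁ hc₁ hΩ₁ k hξ with h | h <;> rw [h, proj_lift] <;> simp
  · rcases IsRiemannSolution.spEnt_eq_or h₂ hc₂ hΩ₂ k hξ with h | h <;> rw [h, proj_lift] <;> simp

lemma le_step_spEnt (k : Fin 2) :
    min (spEnt UL k) (min (spEnt UC k) (spEnt UR k)) ≤ spEnt V k := by
  obtain ⟨S₁, hc₁, hΩ₁⟩ := IsRiemannSolution.exists_constOff h₁
  obtain ⟨S₂, hc₂, hΩ₂⟩ := IsRiemannSolution.exists_constOff h₂
  refine hV.le_spEnt hc₁ hc₂ hx hΩ₁ hΩ₂ k (fun ξ hξ => ?_) fun ξ hξ => ?_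
  · rcases IsRiemannSolution.spEnt_eq_or h₁ hc₁ hΩ₁ k hξ with h | h <;> rw [h, proj_lift] <;> simp
  · rcases IsRiemannSolution.spEnt_eq_or h₂ hc₂ hΩ₂ k hξ with h | h <;> rw [h, proj_lift] <;> simp

lemma step_vol_pos (k : Fin 2) : 0 < vol V k :=
  div_pos (step_alpha_pos h₁ h₂ hV hx k) (step_mass_pos h₁ h₂ hV hx k)

variable (hL : UL ∈ OmegaU eos) (hC : UC ∈ OmegaU eos) (hR : UR ∈ OmegaU eos)
include hL hC hR

/-- An entropy between admissible values is admissible, so the inverse `e(τ, s)` is defined at the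
new state. -/
lemma step_spEnt_mem (k : Fin 2) : spEnt V k ∈ (eos k).entropySet := by
  have mL := spEnt_mem_entropySet_of_mem hL k
  have mC := spEnt_mem_entropySet_of_mem hC k
  have mR := spEnt_mem_entropySet_of_mem hR k
  refine PhaseEOS.convex_entropySet.ordConnected.out ?_ ?_
    ⟨le_step_spEnt h₁ h₂ hV hx k, step_spEnt_le h₁ h₂ hV hx k⟩
  · rcases min_choice (spEnt UL k) (min (spEnt UC k) (spEnt UR k)) with h | h <;> rw [h]
    · exact mL
    · rcases min_choice (spEnt UC k) (spEnt UR k) with h | h <;> rw [h] <;> assumption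
  · rcases max_choice (spEnt UL k) (max (spEnt UC k) (spEnt UR k)) with h | h <;> rw [h]
    · exact mL
    · rcases max_choice (spEnt UC k) (spEnt UR k) with h | h <;> rw [h] <;> assumption

lemma step_intEnergy_pos (k : Fin 2) : 0 < intEnergy eos V k :=
  PhaseEOS.energy_pos (step_vol_pos h₁ h₂ hV hx k) (step_spEnt_mem h₁ h₂ hV hx hL hC hR k)

/-- The physical space is invariant. -/
theorem step_mem_OmegaU : V ∈ OmegaU eos :=
  ⟨step_alpha_pos h₁ h₂ hV hx 0, sub_pos.1 (step_alpha_pos h₁ h₂ hV hx 1), fun k =>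
    ⟨step_mass_pos h₁ h₂ hV hx k, mul_pos (step_mass_pos h₁ h₂ hV hx k)
      (step_intEnergy_pos h₁ h₂ hV hx hL hC hR k)⟩⟩

/-- For a stiffened gas the sharper bound `ρ e > p_∞` is preserved. -/
theorem step_stiffened {k : Fin 2} {γ q : ℝ} (hg : (eos k).IsStiffenedGas γ q)
    (pL : 0 < 1 / vol UL k * intEnergy eos UL k - q)
    (pC : 0 < 1 / vol UC k * intEnergy eos UC k - q)
    (pR : 0 < 1 / vol UR k * intEnergy eos UR k - q) :
    0 < 1 / vol V k * intEnergy eos V k - q := by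
  have hv := step_vol_pos h₁ h₂ hV hx k
  have hs := step_spEnt_mem h₁ h₂ hV hx hL hC hR k
  -- Moving from `U` to the volume of `V` at the entropy of `U` preserves the sign of `ρe - p_∞`;
  -- lowering the entropy to that of `V` then only raises the energy.
  have key : ∀ {U : AuxState}, U ∈ OmegaU eos → 0 < 1 / vol U k * intEnergy eos U k - q →
      spEnt V k ≤ spEnt U k → 0 < 1 / vol V k * intEnergy eos V k - q := by
    intro U hU hp hle
    have hsU := spEnt_mem_entropySet_of_mem hU k
    have h1 := hg.pos_of_pos (vol_pos_of_mem_OmegaU hU k) hv hsU hp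
    have h2 := PhaseEOS.energy_antitone hv hs hsU hle
    have h3 := mul_le_mul_of_nonneg_left h2 (one_div_pos.2 hv).le
    exact h1.trans_le (sub_le_sub_right h3 q)
  rcases le_max_iff.1 (step_spEnt_le h₁ h₂ hV hx k) with h | h
  · exact key hL pL h
  rcases le_max_iff.1 h with h | h
  · exact key hC pC h
  · exact key hR pR h

/-- Jensen's inequality and Whitham's condition: the total energy of the cell average is bounded
by the average of the relaxation energy. -/
theorem step_totEnergy_le (ha₁ : ∀ k, 0 < a₁ k) (ha₂ : ∀ k, 0 < a₂ k)
    (hW₁ : Whitham eos a₁ (interfaceFan Wr a₁ UL UC))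
    (hW₂ : Whitham eos a₂ (interfaceFan Wr a₂ UC UR)) (k : Fin 2) :
    2 * x * totEnergy eos V k ≤
      (∫ ξ in (0 : ℝ)..x, mass (proj ((interfaceFan Wr a₁ UL UC).W ξ)) k
        * relEnergy eos a₁ ((interfaceFan Wr a₁ UL UC).W ξ) k)
      + ∫ ξ in (-x)..0, mass (proj ((interfaceFan Wr a₂ UC UR).W ξ)) k
        * relEnergy eos a₂ ((interfaceFan Wr a₂ UC UR).W ξ) k := by
  obtain ⟨S₁, hc₁, hΩ₁⟩ := IsRiemannSolution.exists_constOff h₁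
  obtain ⟨S₂, hc₂, hΩ₂⟩ := IsRiemannSolution.exists_constOff h₂
  have hv := step_vol_pos h₁ h₂ hV hx k
  have hs := step_spEnt_mem h₁ h₂ hV hx hL hC hR k
  have mL := spEnt_mem_entropySet_of_mem hL k
  have mC := spEnt_mem_entropySet_of_mem hC k
  have mR := spEnt_mem_entropySet_of_mem hR k
  -- Jensen by support: the energy at `V` equals the affine function that touches it there, and
  -- affine functions commute with the cell average.
  rw [← tangent_eq_totEnergy (step_mass_pos h₁ h₂ hV hx k)
    ((eos k).pressure (vol V k) (spEnt V k)) ((eos k).T (1 / vol V k) (intEnergy eos V k))]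
  refine hV.le_of_forall_le hc₁ hc₂ hx k _ _ _ _
    (fun W => mass (proj W) k * relEnergy eos a₁ W k)
    (fun W => mass (proj W) k * relEnergy eos a₂ W k) ?_ ?_
  · filter_upwards [ae_notMem_finset S₁, hW₁ k] with ξ hξ hw
    have hm : spEnt (proj ((interfaceFan Wr a₁ UL UC).W ξ)) k ∈ (eos k).entropySet := by
      rcases IsRiemannSolution.spEnt_eq_or h₁ hc₁ hΩ₁ k hξ with h | h <;> rw [h, proj_lift] <;>
        assumption
    exact (tangent_le_totEnergy (mass_pos_of_mem (hΩ₁ ξ hξ) k) (alpha_pos_of_mem (hΩ₁ ξ hξ) k)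
      hm hv hs).trans (totEnergy_le_relEnergy (ha₁ k) (hΩ₁ ξ hξ) hm hw)
  · filter_upwards [ae_notMem_finset S₂, hW₂ k] with ξ hξ hw
    have hm : spEnt (proj ((interfaceFan Wr a₂ UC UR).W ξ)) k ∈ (eos k).entropySet := by
      rcases IsRiemannSolution.spEnt_eq_or h₂ hc₂ hΩ₂ k hξ with h | h <;> rw [h, proj_lift] <;>
        assumption
    exact (tangent_le_totEnergy (mass_pos_of_mem (hΩ₂ ξ hξ) k) (alpha_pos_of_mem (hΩ₂ ξ hξ) k)
      hm hv hs).trans (totEnergy_le_relEnergy (ha₂ k) (hΩ₂ ξ hξ) hm hw)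

end step

/-- The step of the scheme in the cell `j` is a cell average. -/
lemma IsScheme.isCellAverage {a : ℕ → ℤ → Fin 2 → ℝ} {U : ℕ → ℤ → AuxState}
    (hU : IsScheme eos Wr Δt Δx a U) (ht : 0 < Δt) (hx : 0 < Δx) {n : ℕ}
    (hΩ : ∀ j, U n j ∈ OmegaU eos)
    (hS : ∀ j, SolvesInterface eos Wr (a n j) (U n j) (U n (j + 1)))
    (hC : CFL Δt Δx (a n) (U n)) (j : ℤ) :
    SolvesInterface eos Wr (a n (j - 1)) (U n (j - 1)) (U n j) ∧
    (∀ k, vel (U n j) k + a n (j - 1) k * vol (U n j) k < Δx / (2 * Δt)) ∧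
    (∀ k, -(Δx / (2 * Δt)) < vel (U n j) k - a n j k * vol (U n j) k) ∧
    IsCellAverage (interfaceFan Wr (a n (j - 1)) (U n (j - 1)) (U n j)).W
      (interfaceFan Wr (a n j) (U n j) (U n (j + 1))).W (Δx / (2 * Δt)) (U (n + 1) j) := by
  have h₁ := hS (j - 1)
  have hr := hC.right_lt ht hx (j - 1)
  have hl := hC.lt_left ht hx j
  rw [sub_add_cancel] at h₁ hr
  exact ⟨h₁, hr, hl, isCellAverage_step ht hx h₁ (hS j) (fun k => ((hΩ j).2.2 k).1) hr hl (hU n j)⟩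

end BaerNunziato

/-! ### Assembly of the proposition. -/

theorem mainTheorem2 (eos : Fin 2 → BaerNunziato.PhaseEOS) (Wr : BaerNunziato.RiemannSolver)
    (Δt Δx : ℝ) (hΔt : 0 < Δt) (hΔx : 0 < Δx)
    (a : ℕ → ℤ → Fin 2 → ℝ) (ha : ∀ n j k, 0 < a n j k)
    (U : ℕ → ℤ → BaerNunziato.AuxState)
    (hU : BaerNunziato.IsScheme eos Wr Δt Δx a U) :
    -- positivity
    (∀ n : ℕ, (∀ j, U n j ∈ BaerNunziato.OmegaU eos) →
      (∀ j, BaerNunziato.SolvesInterface eos Wr (a n j) (U n j) (U n (j + 1))) →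
      BaerNunziato.CFL Δt Δx (a n) (U n) →
      (∀ j k, (0 < BaerNunziato.alpha (U (n + 1) j) k ∧ BaerNunziato.alpha (U (n + 1) j) k < 1) ∧
        0 < BaerNunziato.mass (U (n + 1) j) k ∧
        0 < BaerNunziato.mass (U (n + 1) j) k * BaerNunziato.intEnergy eos (U (n + 1) j) k) ∧
      (∀ j, U (n + 1) j ∈ BaerNunziato.OmegaU eos) ∧
      (∀ (k : Fin 2) (γ pinf : ℝ), (eos k).IsStiffenedGas γ pinf →
        (∀ j, 0 < 1 / BaerNunziato.vol (U n j) k * BaerNunziato.intEnergy eos (U n j) k - pinf) →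
        ∀ j, 0 < 1 / BaerNunziato.vol (U (n + 1) j) k
          * BaerNunziato.intEnergy eos (U (n + 1) j) k - pinf)) ∧
    -- conservative fluxes for partial masses, partial entropies and total momentum
    (∀ (b : Fin 2 → ℝ) (UL UR : BaerNunziato.AuxState),
      BaerNunziato.SolvesInterface eos Wr b UL UR →
      (∀ k, BaerNunziato.fluxMinus eos Wr b UL UR (BaerNunziato.massIdx k)
        = BaerNunziato.fluxPlus eos Wr b UL UR (BaerNunziato.massIdx k)) ∧
      (∀ k, BaerNunziato.fluxMinus eos Wr b UL UR (BaerNunziato.entIdx k)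
        = BaerNunziato.fluxPlus eos Wr b UL UR (BaerNunziato.entIdx k)) ∧
      ∑ k, BaerNunziato.fluxMinus eos Wr b UL UR (BaerNunziato.momIdx k)
        = ∑ k, BaerNunziato.fluxPlus eos Wr b UL UR (BaerNunziato.momIdx k)) ∧
    -- conservative updates of partial masses, partial entropies and total momentum
    (∀ n : ℕ, (∀ j, BaerNunziato.SolvesInterface eos Wr (a n j) (U n j) (U n (j + 1))) → ∀ j,
      (∀ k, BaerNunziato.mass (U (n + 1) j) k = BaerNunziato.mass (U n j) k - Δt / Δx *
        (BaerNunziato.fluxMinus eos Wr (a n j) (U n j) (U n (j + 1)) (BaerNunziato.massIdx k)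
          - BaerNunziato.fluxMinus eos Wr (a n (j - 1)) (U n (j - 1)) (U n j)
              (BaerNunziato.massIdx k))) ∧
      (∀ k, BaerNunziato.ent (U (n + 1) j) k = BaerNunziato.ent (U n j) k - Δt / Δx *
        (BaerNunziato.fluxMinus eos Wr (a n j) (U n j) (U n (j + 1)) (BaerNunziato.entIdx k)
          - BaerNunziato.fluxMinus eos Wr (a n (j - 1)) (U n (j - 1)) (U n j)
              (BaerNunziato.entIdx k))) ∧
      (∑ k, BaerNunziato.mom (U (n + 1) j) k) = (∑ k, BaerNunziato.mom (U n j) k) - Δt / Δx *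
        ((∑ k, BaerNunziato.fluxMinus eos Wr (a n j) (U n j) (U n (j + 1)) (BaerNunziato.momIdx k))
          - ∑ k, BaerNunziato.fluxMinus eos Wr (a n (j - 1)) (U n (j - 1)) (U n j)
              (BaerNunziato.momIdx k))) ∧
    -- discrete energy inequalities
    (∀ n : ℕ, (∀ j, U n j ∈ BaerNunziato.OmegaU eos) →
      (∀ j, BaerNunziato.SolvesInterface eos Wr (a n j) (U n j) (U n (j + 1))) →
      BaerNunziato.CFL Δt Δx (a n) (U n) →
      (∀ j, BaerNunziato.Whitham eos (a n j)
        (BaerNunziato.interfaceFan Wr (a n j) (U n j) (U n (j + 1)))) →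
      ∀ j k, BaerNunziato.totEnergy eos (U (n + 1) j) k ≤
        BaerNunziato.totEnergy eos (U n j) k
        - Δt / Δx *
          (BaerNunziato.interfaceEnergyFlux eos Wr (a n j) (U n j) (U n (j + 1)) k
            - BaerNunziato.interfaceEnergyFlux eos Wr (a n (j - 1)) (U n (j - 1)) (U n j) k)
        + Δt / Δx *
          (if 0 ≤ (BaerNunziato.interfaceFan Wr (a n (j - 1)) (U n (j - 1)) (U n j)).u2 then
            (BaerNunziato.interfaceFan Wr (a n (j - 1)) (U n (j - 1)) (U n j)).u2
              * (BaerNunziato.interfaceFan Wr (a n (j - 1)) (U n (j - 1)) (U n j)).pi1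
              * (BaerNunziato.alpha (U n j) k - BaerNunziato.alpha (U n (j - 1)) k) else 0)
        + Δt / Δx *
          (if (BaerNunziato.interfaceFan Wr (a n j) (U n j) (U n (j + 1))).u2 ≤ 0 then
            (BaerNunziato.interfaceFan Wr (a n j) (U n j) (U n (j + 1))).u2
              * (BaerNunziato.interfaceFan Wr (a n j) (U n j) (U n (j + 1))).pi1
              * (BaerNunziato.alpha (U n (j + 1)) k - BaerNunziato.alpha (U n j) k) else 0)) := by
  refine ⟨fun n hΩ hS hC => ?_, fun b UL UR h => ⟨h.fluxMinus_mass_eq, h.fluxMinus_ent_eq,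
    h.sum_fluxMinus_mom_eq⟩, fun n hS j => ?_, fun n hΩ hS hC hW j k => ?_⟩
  · have hx' : 0 < Δx / (2 * Δt) := by positivity
    have hmem : ∀ j, U (n + 1) j ∈ BaerNunziato.OmegaU eos := fun j => by
      obtain ⟨h₁, -, -, hV⟩ := hU.isCellAverage hΔt hΔx hΩ hS hC j
      exact BaerNunziato.step_mem_OmegaU h₁ (hS j) hV hx' (hΩ _) (hΩ _) (hΩ _)
    refine ⟨fun j k => ⟨?_, (hmem j).2.2 k⟩, hmem, fun k γ q hg hp j => ?_⟩
    · have h0 := (hmem j).1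
      have h1 := (hmem j).2.1
      fin_cases k
      · exact ⟨h0, h1⟩
      · exact ⟨sub_pos.2 h1, sub_lt_self _ h0⟩
    · obtain ⟨h₁, -, -, hV⟩ := hU.isCellAverage hΔt hΔx hΩ hS hC j
      exact BaerNunziato.step_stiffened h₁ (hS j) hV hx' (hΩ _) (hΩ _) (hΩ _) hg (hp _) (hp _)
        (hp _)
  · have h₁ := hS (j - 1)
    rw [sub_add_cancel] at h₁
    have hc : ∀ i, U (n + 1) j i = U n j i - Δt / Δx *
        (BaerNunziato.fluxMinus eos Wr (a n j) (U n j) (U n (j + 1)) i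
          - BaerNunziato.fluxPlus eos Wr (a n (j - 1)) (U n (j - 1)) (U n j) i) := fun i => by
      rw [hU n j]
      rfl
    refine ⟨fun k => ?_, fun k => ?_, ?_⟩
    · rw [h₁.fluxMinus_mass_eq k]
      exact hc _
    · rw [h₁.fluxMinus_ent_eq k]
      exact hc _
    · rw [h₁.sum_fluxMinus_mom_eq]
      simp only [BaerNunziato.mom, hc, Fin.sum_univ_two]
      ring
  · have hx' : 0 < Δx / (2 * Δt) := by positivity
    obtain ⟨h₁, hr, hl, hV⟩ := hU.isCellAverage hΔt hΔx hΩ hS hC j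
    have hW₁ := hW (j - 1)
    rw [sub_add_cancel] at hW₁
    have h := BaerNunziato.step_totEnergy_le h₁ (hS j) hV hx' (hΩ _) (hΩ _) (hΩ _)
      (ha n (j - 1)) (ha n j) hW₁ (hW j) k
    have hR := h₁.integral_energy_right hx' k hr
    have hL := (hS j).integral_energy_left hx' k hl
    -- The energy fluxes of the cell state, computed with the parameters of its two interfaces,
    -- coincide and cancel in the sum of the half-fan estimates.
    rw [BaerNunziato.energyFlux_lift (a n (j - 1)) (a n j)] at hR
    have hxx : Δt / Δx * (2 * (Δx / (2 * Δt))) = 1 := by field_simp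
    have hsum := mul_le_mul_of_nonneg_left (h.trans (add_le_add hR hL))
      (div_pos hΔt hΔx).le
    linear_combination hsum + (BaerNunziato.totEnergy eos (U n j) k
      - BaerNunziato.totEnergy eos (U (n + 1) j) k) * hxx
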